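/- Let $m\ge 1$ and let $H_1,\dots,H_m$ be arbitrary separable complex Hilbert spaces, with Hilbert space tensor product $H=H_1\otimes\cdots\otimes H_m$; for $B\subseteq[m]=\{1,\dots,m\}$ put $H_B=\bigotimes_{i\in B}H_i$. Let $\mathcal T(H)$ be the space of trace-class operators on $H$ with the trace norm $\|T\|_1=\operatorname{Tr}\sqrt{T^\dagger T}$. Its weak*-topology is the coarsest topology making all maps $T\mapsto\operatorname{Tr}(TK)$, with $K$ a compact operator on $H$, continuous. A state is a positive semi-definite $\rho\in\mathcal T(H)$ with $\operatorname{Tr}\rho=1$. For a set $S\subseteq \mathcal T(H)$ let $\operatorname{cone}(S)=\{\lambda X:\lambda\in[0,\infty),\,X\in S\}$. For a non-empty set $\pi$ of partitions of $[m]$ (into non-empty, pairwise disjoint blocks), the set $\mathcal S^\pi$ of $\pi$-separable states is the trace-norm closure of the convex hull of all the projectors $|\Psi\rangle\langle\Psi|$ with $\Psi=\bigotimes_{B\in p}\Psi_B$, where $p\in\pi$ and each $\Psi_B\in H_B$ is a unit vector. The $k$-separable states are obtained when $\pi$ consists of all partitions into at least $k$ blocks, the $k$-producible states when $\pi$ consists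 of all partitions into blocks of at most $k$ elements. For positive semi-definite $X,Y\in\mathcal T(H)$ with spectral decompositions $X=\sum_i x_i|e_i\rangle\langle e_i|$ and $Y=\sum_j y_j|f_j\rangle\langle f_j|$, where $(e_i)_i$ and $(f_j)_j$ are orthonormal bases of $H$, let $$D(X\|Y)=\sum_{i,j}|\langle e_i,f_j\rangle|^2\,(x_i\ln x_i-x_i\ln y_j+y_j-x_i)\in[0,+\infty],$$ with the conventions $0\ln 0=0$, $-x\ln 0=+\infty$ for $x>0$, and $0\cdot\infty=0$. For a state $\rho$ let $E_{R,\pi}(\rho)=\inf_{\sigma\in\mathcal S^\pi}D(\rho\|\sigma)$ be the relative entropy of $\pi$-entanglement. Then for every non-empty set $\pi$ of partitions of $[m]$: 1. $\operatorname{cone}(\mathcal S^\pi)$ is weak*-closed. In particular, the cones generated by the $k$-separable states and by the $k$-producible states are weak*-closed for every integer $1\le k\le m$. 2. $E_{R,\pi}$ is always attained: for every state $\rho$ on $H$ there is a state $\sigma\in\mathcal S^\pi$ with $E_{R,\pi}(\rho)=D(\rho\|\sigma)$. 3. $E_{R,\pi}$ is lower semi-continuous in the trace norm: if $\rho_n$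 ($n\in\mathbb N$) and $\rho$ are states on $H$ with $\|\rho_n-\rho\|_1\to0$, then $E_{R,\pi}(\rho)\le\liminf_{n\to\infty}E_{R,\pi}(\rho_n)$. -/

import Mathlib

open scoped ENNReal Topology InnerProductSpace

noncomputable section

namespace PiEntanglement

/-! ### Trace, trace norm, trace-class operators -/

section TraceClass

variable {H : Type*} [NormedAddCommGroup H] [InnerProductSpace ℂ H] [CompleteSpace H]

variable (H) in
/-- The index set of a fixed orthonormal basis of `H`. -/
def basisIndex : Set H := (exists_hilbertBasis ℂ H).choose

variable (H) in
/-- A fixed orthonormal basis of `H`. -/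
def someBasis : HilbertBasis (basisIndex H) ℂ H := (exists_hilbertBasis ℂ H).choose_spec.choose

/-- The trace norm `‖T‖₁ = Tr √(T† T)`, with values in `[0, ∞]`. -/
def traceNorm (T : H →L[ℂ] H) : ℝ≥0∞ :=
  ∑' i, ENNReal.ofReal (RCLike.re ⟪someBasis H i, CFC.abs T (someBasis H i)⟫_ℂ)

/-- `T` is of trace class. -/
def IsTraceClass (T : H →L[ℂ] H) : Prop := traceNorm T < ∞

/-- The trace `Tr T = ∑ᵢ ⟨eᵢ, T eᵢ⟩`, meaningful for `T` of trace class. -/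
def trace (T : H →L[ℂ] H) : ℂ := ∑' i, ⟪someBasis H i, T (someBasis H i)⟫_ℂ

/-- Density operators: positive semi-definite trace-class operators of unit trace. -/
def IsState (ρ : H →L[ℂ] H) : Prop := ρ.IsPositive ∧ IsTraceClass ρ ∧ trace ρ = 1

variable (H) in
/-- The space of trace-class operators on `H`. -/
def TraceClass : Type _ := {T : H →L[ℂ] H // IsTraceClass T}

variable (H) in
/-- The weak*-topology on the trace-class operators: the coarsest topology making every map
`T ↦ Tr (T K)` continuous, where `K` is a compact operator. -/
abbrev weakStar : TopologicalSpace (TraceClass H) :=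
  ⨅ K : {K : H →L[ℂ] H // IsCompactOperator K},
    TopologicalSpace.induced (fun T : TraceClass H => trace (T.1 * K.1)) inferInstance

/-- A set of trace-class operators (given as a set of bounded operators) is weak*-closed. -/
def IsWeakStarClosed (S : Set (H →L[ℂ] H)) : Prop :=
  (∀ T ∈ S, IsTraceClass T) ∧ IsClosed[weakStar H] {T : TraceClass H | T.1 ∈ S}

/-- `cone S = {λ X : λ ∈ [0, ∞), X ∈ S}`. -/
def cone (S : Set (H →L[ℂ] H)) : Set (H →L[ℂ] H) :=
  {T | ∃ c : ℝ, 0 ≤ c ∧ ∃ X ∈ S, T = c • X}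

/-- The closure of a set of operators in the space of trace-class operators with respect to the
trace norm. -/
def traceNormClosure (S : Set (H →L[ℂ] H)) : Set (H →L[ℂ] H) :=
  {T | IsTraceClass T ∧ ∀ ε : ℝ≥0∞, 0 < ε → ∃ X ∈ S, traceNorm (T - X) < ε}

/-! ### Relative entropy -/

/-- `x ln x - x ln y + y - x` for `x, y ≥ 0`, with the conventions `0 ln 0 = 0 ln y = 0` and
`- x ln 0 = +∞` for `x > 0`. -/
def entropyTerm (x y : ℝ) : ℝ≥0∞ :=
  if x = 0 then ENNReal.ofReal y
  else if y = 0 then ∞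
  else ENNReal.ofReal (x * Real.log x - x * Real.log y + y - x)

/-- `T = ∑ᵢ xᵢ |eᵢ⟩⟨eᵢ|` is a spectral decomposition of `T`, where `e` is an orthonormal basis of
the whole space (eigenvalues may vanish). -/
def IsSpectralDecomposition {ι : Type*} (T : H →L[ℂ] H) (e : HilbertBasis ι ℂ H)
    (x : ι → ℝ) : Prop :=
  ∀ i, T (e i) = (x i : ℂ) • e i

/-- The series `∑ᵢⱼ |⟨eᵢ, fⱼ⟩|² (xᵢ ln xᵢ - xᵢ ln yⱼ + yⱼ - xᵢ)`. -/
def entropySeries {ι κ : Type*} (e : HilbertBasis ι ℂ H) (f : HilbertBasis κ ℂ H)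
    (x : ι → ℝ) (y : κ → ℝ) : ℝ≥0∞ :=
  ∑' (i : ι) (j : κ), ENNReal.ofReal (‖⟪e i, f j⟫_ℂ‖ ^ 2) * entropyTerm (x i) (y j)

/-- The relative entropy `D(X‖Y)` of two positive semi-definite trace-class operators. The series
takes the same value for all spectral decompositions of `X` and `Y`, see `relEntropy_eq`; the
infimum only serves to select that value. -/
def relEntropy (X Y : H →L[ℂ] H) : ℝ≥0∞ :=
  ⨅ (s : Set H) (t : Set H) (e : HilbertBasis s ℂ H) (f : HilbertBasis t ℂ H)
    (x : s → ℝ) (y : t → ℝ) (_ : IsSpectralDecomposition X e x)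
    (_ : IsSpectralDecomposition Y f y), entropySeries e f x y

theorem IsSpectralDecomposition.inner_map {ι : Type*} {T : H →L[ℂ] H} {e : HilbertBasis ι ℂ H}
    {x : ι → ℝ} (h : IsSpectralDecomposition T e x) (i : ι) (w : H) :
    ⟪e i, T w⟫_ℂ = x i * ⟪e i, w⟫_ℂ := by
  classical
  have h1 := ((e.hasSum_repr w).mapL T).mapL (innerSL ℂ (e i))
  have h3 : (fun j => innerSL ℂ (e i) (T ((e.repr w) j • e j))) =
      fun j => if j = i then x i * ⟪e i, w⟫_ℂ else 0 := by
    funext j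
    rw [map_smul, h j, map_smul, map_smul, innerSL_apply_apply, e.repr_apply_apply]
    by_cases hj : j = i
    · subst hj
      simp [e.orthonormal.1 j, mul_comm]
    · have : ⟪e i, e j⟫_ℂ = 0 := e.orthonormal.2 (Ne.symm hj)
      simp [hj, this]
  rw [h3] at h1
  exact h1.unique (hasSum_ite_eq i (x i * ⟪e i, w⟫_ℂ))

theorem tsum_sq_norm_inner {ι : Type*} (e : HilbertBasis ι ℂ H) (v : H) :
    ∑' i, ENNReal.ofReal (‖⟪e i, v⟫_ℂ‖ ^ 2) = ENNReal.ofReal (‖v‖ ^ 2) := by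
  have h := (e.hasSum_inner_mul_inner v v).mapL Complex.reCLM
  have h2 : HasSum (fun i => ‖⟪e i, v⟫_ℂ‖ ^ 2) (‖v‖ ^ 2) := by
    convert h using 1
    · ext i
      rw [← inner_conj_symm v (e i), ← Complex.normSq_eq_conj_mul_self]
      simp only [Complex.normSq_eq_norm_sq, Complex.reCLM_apply, Complex.ofReal_re]
    · simp [inner_self_eq_norm_sq_to_K, ← Complex.ofReal_pow]
  rw [← h2.tsum_eq, ENNReal.ofReal_tsum_of_nonneg (fun i => by positivity) h2.summable]

/-- Sums over the eigenvectors can be grouped by eigenspaces. -/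
theorem IsSpectralDecomposition.tsum_eq {ι : Type*} {T : H →L[ℂ] H} {e : HilbertBasis ι ℂ H}
    {x : ι → ℝ} (h : IsSpectralDecomposition T e x) (v : H) (g : ℝ → ℝ≥0∞) :
    ∑' i, ENNReal.ofReal (‖⟪e i, v⟫_ℂ‖ ^ 2) * g (x i) =
      ∑' a : ℝ, ENNReal.ofReal (‖(T - (a : ℂ) • ContinuousLinearMap.id ℂ H).ker.starProjection v‖
        ^ 2) * g a := by
  classical
  have key : ∀ a : ℝ, ∀ i,
      ⟪e i, (T - (a : ℂ) • ContinuousLinearMap.id ℂ H).ker.starProjection v⟫_ℂ =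
        if x i = a then ⟪e i, v⟫_ℂ else 0 := by
    intro a i
    set K := (T - (a : ℂ) • ContinuousLinearMap.id ℂ H).ker with hK
    split_ifs with hi
    · have hmem : e i ∈ K := by
        rw [hK, LinearMap.mem_ker]
        simp [h i, hi]
      rw [← Submodule.inner_starProjection_left_eq_right, Submodule.starProjection_eq_self_iff.2 hmem]
    · have hm : K.starProjection v ∈ K := Submodule.starProjection_apply_mem _ _
      have hm := LinearMap.mem_ker.1 hm
      have h1 : T (K.starProjection v) = (a : ℂ) • K.starProjection v := by
        simpa [sub_eq_zero] using hm
      have h2 := h.inner_map i (K.starProjection v)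
      rw [h1, inner_smul_right] at h2
      have h3 : ((a : ℂ) - x i) * ⟪e i, K.starProjection v⟫_ℂ = 0 := by
        rw [sub_mul, h2, sub_self]
      rcases mul_eq_zero.1 h3 with h4 | h4
      · exact absurd (by exact_mod_cast (sub_eq_zero.1 h4).symm) hi
      · exact h4
  simp_rw [← tsum_sq_norm_inner e, key, ← ENNReal.tsum_mul_right]
  rw [ENNReal.tsum_comm]
  refine tsum_congr fun i => ?_
  rw [tsum_eq_single (x i)]
  · simp
  · intro a ha
    simp [Ne.symm ha]

theorem entropySeries_eq {ι κ ι' κ' : Type*} {X Y : H →L[ℂ] H}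
    {e : HilbertBasis ι ℂ H} {f : HilbertBasis κ ℂ H} {x : ι → ℝ} {y : κ → ℝ}
    {e' : HilbertBasis ι' ℂ H} {f' : HilbertBasis κ' ℂ H} {x' : ι' → ℝ} {y' : κ' → ℝ}
    (hX : IsSpectralDecomposition X e x) (hY : IsSpectralDecomposition Y f y)
    (hX' : IsSpectralDecomposition X e' x') (hY' : IsSpectralDecomposition Y f' y') :
    entropySeries e f x y = entropySeries e' f' x' y' := by
  unfold entropySeries
  calc _ = ∑' (i : ι) (j : κ'), ENNReal.ofReal (‖⟪e i, f' j⟫_ℂ‖ ^ 2) * entropyTerm (x i) (y' j) := by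
        refine tsum_congr fun i => ?_
        simp_rw [fun u : H => norm_inner_symm (𝕜 := ℂ) (e i) u]
        rw [hY.tsum_eq (e i) (entropyTerm (x i)), hY'.tsum_eq (e i) (entropyTerm (x i))]
    _ = _ := by
        rw [ENNReal.tsum_comm, ENNReal.tsum_comm (α := ι')]
        refine tsum_congr fun j => ?_
        rw [hX.tsum_eq (f' j) fun a => entropyTerm a (y' j),
          hX'.tsum_eq (f' j) fun a => entropyTerm a (y' j)]

theorem IsSpectralDecomposition.exists_set {ι : Type*} {T : H →L[ℂ] H} {e : HilbertBasis ι ℂ H}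
    {x : ι → ℝ} (h : IsSpectralDecomposition T e x) :
    ∃ (s : Set H) (e' : HilbertBasis s ℂ H) (x' : s → ℝ), IsSpectralDecomposition T e' x' := by
  have hsp : ⊤ ≤ (Submodule.span ℂ (Set.range ((↑) : Set.range e → H))).topologicalClosure := by
    rw [Subtype.range_coe]
    exact e.dense_span.ge
  refine ⟨Set.range e, HilbertBasis.mk e.orthonormal.toSubtypeRange hsp,
    fun v => x v.2.choose, fun v => ?_⟩
  rw [HilbertBasis.coe_mk]
  have := h v.2.choose
  rwa [v.2.choose_spec] at this

/-- The relative entropy is the value of the series for any choice of spectral decompositions. -/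
theorem relEntropy_eq {ι κ : Type*} {X Y : H →L[ℂ] H}
    {e : HilbertBasis ι ℂ H} {f : HilbertBasis κ ℂ H} {x : ι → ℝ} {y : κ → ℝ}
    (hX : IsSpectralDecomposition X e x) (hY : IsSpectralDecomposition Y f y) :
    relEntropy X Y = entropySeries e f x y := by
  apply le_antisymm
  · obtain ⟨s, e', x', hX'⟩ := hX.exists_set
    obtain ⟨t, f', y', hY'⟩ := hY.exists_set
    rw [entropySeries_eq hX hY hX' hY']
    exact iInf_le_of_le s <| iInf_le_of_le t <| iInf_le_of_le e' <| iInf_le_of_le f' <|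
      iInf_le_of_le x' <| iInf_le_of_le y' <| iInf_le_of_le hX' <| iInf_le_of_le hY' le_rfl
  · refine le_iInf fun s => le_iInf fun t => le_iInf fun e' => le_iInf fun f' => le_iInf fun x' =>
      le_iInf fun y' => le_iInf fun hX' => le_iInf fun hY' => ?_
    exact (entropySeries_eq hX hY hX' hY').le

/-- The relative entropy of resource `D_F(ρ) = inf_{σ ∈ F} D(ρ‖σ)`. -/
def relEntropyOfResource (F : Set (H →L[ℂ] H)) (ρ : H →L[ℂ] H) : ℝ≥0∞ :=
  ⨅ σ ∈ F, relEntropy ρ σ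

end TraceClass

/-! ### Hilbert tensor products of finite families -/

section Tensor

open scoped ComplexOrder in
theorem gram_posSemidef {𝕜 : Type*} [RCLike 𝕜] {ι : Type*} {E : ι → Type*}
    [∀ i, NormedAddCommGroup (E i)] [∀ i, InnerProductSpace 𝕜 (E i)]
    {n : Type*} [Fintype n] (v : n → ∀ i, E i) (I : Finset ι) :
    (Matrix.of fun k l => ∏ i ∈ I, inner 𝕜 (v k i) (v l i) : Matrix n n 𝕜).PosSemidef := by
  classical
  induction I using Finset.induction_on with
  | empty =>
    have h : (Matrix.of fun k l => ∏ i ∈ (∅ : Finset ι), inner 𝕜 (v k i) (v l i) : Matrix n n 𝕜)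
        = Matrix.gram 𝕜 (fun _ : n => (1 : 𝕜)) := by
      ext k l
      simp [Matrix.gram_apply]
    rw [h]
    exact Matrix.posSemidef_gram 𝕜 _
  | insert i I hi ih =>
    have h : (Matrix.of fun k l => ∏ i ∈ insert i I, inner 𝕜 (v k i) (v l i) : Matrix n n 𝕜)
        = (Matrix.gram 𝕜 (fun k => v k i)).hadamard
          (Matrix.of fun k l => ∏ i ∈ I, inner 𝕜 (v k i) (v l i)) := by
      ext k l
      simp [Matrix.gram_apply, Finset.prod_insert hi]
    rw [h]
    exact (Matrix.posSemidef_gram 𝕜 _).hadamard ih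

open scoped ComplexOrder in
theorem re_sum_gram_nonneg {𝕜 : Type*} [RCLike 𝕜] {ι : Type*} {E : ι → Type*}
    [∀ i, NormedAddCommGroup (E i)] [∀ i, InnerProductSpace 𝕜 (E i)]
    (S : Finset (∀ i, E i)) (a : (∀ i, E i) → 𝕜) (I : Finset ι) :
    0 ≤ RCLike.re (∑ x ∈ S, ∑ y ∈ S, starRingEnd 𝕜 (a x) * a y * ∏ i ∈ I, inner 𝕜 (x i) (y i)) := by
  have h := (gram_posSemidef (𝕜 := 𝕜) (fun k : S => k.1) I).dotProduct_mulVec_nonneg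
    (fun k => a k.1)
  have h2 := (RCLike.le_iff_re_im.1 h).1
  simp only [map_zero] at h2
  convert h2 using 2
  simp only [dotProduct, Matrix.mulVec, Matrix.of_apply, Pi.star_apply]
  rw [← Finset.sum_coe_sort]
  refine Finset.sum_congr rfl fun k _ => ?_
  rw [← Finset.sum_coe_sort, Finset.mul_sum]
  refine Finset.sum_congr rfl fun l _ => ?_
  simp only [starRingEnd_apply]
  ring

variable {ι : Type*} [Fintype ι] (E : ι → Type*) [∀ i, NormedAddCommGroup (E i)]
  [∀ i, InnerProductSpace ℂ (E i)]

/-- Formal finite linear combinations of elementary tensors. -/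
def PreTensor : Type _ := (∀ i, E i) →₀ ℂ

instance : AddCommGroup (PreTensor E) := inferInstanceAs (AddCommGroup ((∀ i, E i) →₀ ℂ))

instance : Module ℂ (PreTensor E) := inferInstanceAs (Module ℂ ((∀ i, E i) →₀ ℂ))

variable {E} in
/-- The sesquilinear form determined by `⟨⊗ᵢ xᵢ, ⊗ᵢ yᵢ⟩ = ∏ᵢ ⟨xᵢ, yᵢ⟩`. -/
def preInner (s t : (∀ i, E i) →₀ ℂ) : ℂ :=
  s.sum fun x a => t.sum fun y b => starRingEnd ℂ a * b * ∏ i, ⟪x i, y i⟫_ℂ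

theorem preInner_self_nonneg (s : (∀ i, E i) →₀ ℂ) : 0 ≤ (preInner s s).re :=
  re_sum_gram_nonneg (𝕜 := ℂ) s.support s Finset.univ

instance : PreInnerProductSpace.Core ℂ (PreTensor E) where
  inner s t := preInner (E := E) s t
  conj_inner_symm s t := by
    change starRingEnd ℂ (preInner (E := E) t s) = preInner (E := E) s t
    simp only [preInner, Finsupp.sum, map_sum, map_mul, map_prod, inner_conj_symm,
      Complex.conj_conj]
    rw [Finset.sum_comm]
    refine Finset.sum_congr rfl fun x _ => Finset.sum_congr rfl fun y _ => ?_
    ring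
  re_inner_nonneg s := preInner_self_nonneg E s
  add_left s t u := by
    refine Finsupp.sum_add_index' (f := s) (g := t) ?_ ?_
    · intro x
      simp [Finsupp.sum]
    · intro x a b
      simp [Finsupp.sum, add_mul, Finset.sum_add_distrib]
  smul_left s t r := by
    refine (Finsupp.sum_smul_index' (g := s) (b := r) ?_).trans ?_
    · intro x
      simp [Finsupp.sum]
    · change _ = _ * preInner (E := E) s t
      simp only [preInner, Finsupp.sum, Finset.mul_sum, smul_eq_mul, map_mul, mul_assoc]

instance : SeminormedAddCommGroup (PreTensor E) :=
  InnerProductSpace.Core.toSeminormedAddCommGroup (𝕜 := ℂ)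

instance : InnerProductSpace ℂ (PreTensor E) := .ofCore _

/-- The Hilbert space tensor product `⨂ᵢ Eᵢ` of a finite family: formal linear combinations of
elementary tensors, separated and completed with respect to the inner product determined by
`⟨⊗ᵢ xᵢ, ⊗ᵢ yᵢ⟩ = ∏ᵢ ⟨xᵢ, yᵢ⟩`. -/
abbrev HTensor : Type _ := UniformSpace.Completion (PreTensor E)

variable {E}

/-- The formal multiple `a · ⊗ᵢ xᵢ` of an elementary tensor. -/
def preTmul (x : ∀ i, E i) (a : ℂ) : PreTensor E := Finsupp.single x a

/-- The elementary tensor `⊗ᵢ xᵢ`. -/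
def tmul (x : ∀ i, E i) : HTensor E := (preTmul x 1 : PreTensor E)

theorem inner_tmul (x y : ∀ i, E i) : ⟪tmul x, tmul y⟫_ℂ = ∏ i, ⟪x i, y i⟫_ℂ := by
  rw [tmul, tmul, UniformSpace.Completion.inner_coe]
  change preInner (Finsupp.single x 1) (Finsupp.single y 1) = _
  simp [preInner]

theorem dense_span_tmul :
    Dense (Submodule.span ℂ (Set.range (tmul : (∀ i, E i) → HTensor E)) : Set (HTensor E)) := by
  refine (UniformSpace.Completion.denseRange_coe (α := PreTensor E)).mono ?_
  rintro _ ⟨s, rfl⟩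
  have key : ∀ s : PreTensor E, s ∈ Submodule.span ℂ (Set.range fun x : ∀ i, E i => preTmul x 1) := by
    intro s
    refine Finsupp.induction_linear (motive := fun s =>
      (s : PreTensor E) ∈ Submodule.span ℂ (Set.range fun x : ∀ i, E i => preTmul x 1)) s ?_ ?_ ?_
    · exact Submodule.zero_mem _
    · intro f g hf hg
      exact Submodule.add_mem _ hf hg
    · intro x a
      have h : preTmul x a = a • preTmul x 1 :=
        (by simp : Finsupp.single x a = a • (Finsupp.single x (1 : ℂ)))
      change preTmul x a ∈ _
      rw [h]
      exact Submodule.smul_mem _ _ (Submodule.subset_span ⟨x, rfl⟩)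
  refine Submodule.span_induction (p := fun (s : PreTensor E) _ => (s : HTensor E) ∈
    Submodule.span ℂ (Set.range (tmul (E := E)))) ?_ ?_ ?_ ?_ (key s)
  · rintro _ ⟨x, rfl⟩
    exact Submodule.subset_span ⟨x, rfl⟩
  · rw [UniformSpace.Completion.coe_zero]
    exact Submodule.zero_mem _
  · intro s t _ _ hs ht
    rw [UniformSpace.Completion.coe_add]
    exact Submodule.add_mem _ hs ht
  · intro a s _ hs
    rw [UniformSpace.Completion.coe_smul]
    exact Submodule.smul_mem _ _ hs

end Tensor

/-! ### Partition-separable states -/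

section Separable

variable {m : ℕ} (H : Fin m → Type*) [∀ i, NormedAddCommGroup (H i)]
  [∀ i, InnerProductSpace ℂ (H i)]

/-- Partitions of `[m]` into non-empty, pairwise disjoint blocks. -/
abbrev Partition (m : ℕ) : Type := Finpartition (Finset.univ : Finset (Fin m))

/-- The Hilbert space of the joint system formed by the parties in the block `B`. -/
abbrev BlockSpace (B : Finset (Fin m)) : Type _ := HTensor fun i : B => H i

variable {H}

/-- `Ψ = ⨂_B Ψ_B`, the tensor product being over the blocks `B` of the partition `p`, where
`⨂_B H_B` is identified with `⨂ᵢ Hᵢ`. As elementary tensors span a dense subspace, this is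
expressed through the inner products with them:
`⟨⊗ᵢ xᵢ, Ψ⟩ = ∏_B ⟨⊗_{i ∈ B} xᵢ, Ψ_B⟩`. -/
def IsBlockProduct (p : Partition m) (Φ : ∀ B : p.parts, BlockSpace H B.1)
    (Ψ : HTensor H) : Prop :=
  ∀ x : ∀ i, H i, ⟪tmul x, Ψ⟫_ℂ = ∏ B : p.parts, ⟪tmul fun i : B.1 => x i, Φ B⟫_ℂ

variable (H) in
/-- The projectors `|Ψ⟩⟨Ψ|` onto product vectors `Ψ = ⨂_B Ψ_B` with unit vectors `Ψ_B`, `B`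
running over the blocks of some partition in `P`. -/
def pureProductStates (P : Set (Partition m)) : Set (HTensor H →L[ℂ] HTensor H) :=
  {T | ∃ p ∈ P, ∃ (Φ : ∀ B : p.parts, BlockSpace H B.1) (Ψ : HTensor H),
    (∀ B, ‖Φ B‖ = 1) ∧ IsBlockProduct p Φ Ψ ∧ T = InnerProductSpace.rankOne ℂ Ψ Ψ}

variable (H) in
/-- The set of `P`-separable states: trace-norm closed convex hull of the pure product states. -/
def separableStates (P : Set (Partition m)) : Set (HTensor H →L[ℂ] HTensor H) :=
  traceNormClosure (convexHull ℝ (pureProductStates H P))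

/-- Partitions into at least `k` blocks, defining the `k`-separable states. -/
def kSeparable (m k : ℕ) : Set (Partition m) := {p | k ≤ p.parts.card}

/-- Partitions into blocks of at most `k` elements, defining the `k`-producible states. -/
def kProducible (m k : ℕ) : Set (Partition m) := {p | ∀ B ∈ p.parts, B.card ≤ k}

variable (H) in
/-- The relative entropy of `P`-entanglement. -/
def relEntropyOfEntanglement (P : Set (Partition m)) (ρ : HTensor H →L[ℂ] HTensor H) : ℝ≥0∞ :=
  relEntropyOfResource (separableStates H P) ρ

end Separable

end PiEntanglement

end

open scoped ENNReal Topology InnerProductSpace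

noncomputable section

namespace PiEntanglement

/-! Throughout, weak* convergence is used only through matrix elements `⟪u, T v⟫`; these are
weak*-continuous because rank-one operators are compact.

Closedness of the cone. Let `Q` be a tensor product of finite-rank basis projections, one for each
party. It maps a product vector over any partition to a product vector over the same partition, so
`X ↦ Q X Q` preserves the cone over the convex hull of pure product states (`compression_mem_cone`).
If `T` is approximated in matrix elements by `S` in the closed cone, then `T` is positive, `Q T Q`
is close to `T` in trace norm for large `Q` (`tendsto_traceNorm_sub_compression`), and on the
finite-dimensional corner of `Q` matrix elements control the trace norm, so `Q S Q` is close to `Q T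
Q`. Thus `T` is a trace-norm limit of elements of the cone (`mem_cone_of_approx`). Taking cones
commutes with trace-norm closure since all generators have trace norm one (`cone_traceNormClosure`).

Lower semi-continuity of `D`. For `x, y ≥ 0`, the term `x ln x - x ln y + y - x` equals the integral
over `s > 0` of `(y - x)² / (y + s x)` against `(1 + s)⁻² ds`. For fixed `s`, the resulting double
series in the spectral data of `X` and `Y` is, by completing squares, the supremum over finite-rank
`Z` of `2 Re Tr Z†(Y - X) - Tr Z Y Z† - s Tr Z† X Z` (`chiMinorant_le`, `chiMinorant_eq`). Each such
expression involves finitely many matrix elements of `X` and `Y`, so the supremum is lower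
semi-continuous, and Fatou's lemma passes this on to `D` (`relEntropy_le_liminf`).

Attainment and semi-continuity of the infimum. Separable states `σₙ` have a subsequence converging
in matrix elements to a positive `T` of trace at most one, which lies in the cone: `T = c σ` with `c
≤ 1`. Trace may escape in the limit, but this does no harm: `D(ρ‖cσ) = D(ρ‖σ) - ln c - (1 - c) ≥
D(ρ‖σ)` for `0 < c ≤ 1`, while `D(ρ‖0) = ∞`. Hence `σ` is at least as good as `T`, and
`exists_relEntropy_le` yields both remaining claims. -/

set_option linter.unusedSectionVars false

/-! ### Hilbert–Schmidt norm, polar decomposition and the trace norm. -/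

section TraceNorm

open ContinuousLinearMap (adjoint)

variable {H : Type*} [NormedAddCommGroup H] [InnerProductSpace ℂ H] [CompleteSpace H]

/-- The squared Hilbert–Schmidt norm, computed in the basis `e`. -/
def hsNormSq {ι : Type*} (e : HilbertBasis ι ℂ H) (A : H →L[ℂ] H) : ℝ≥0∞ :=
  ∑' i, ENNReal.ofReal (‖A (e i)‖ ^ 2)

/-- By Parseval both sides are the sum of all squared matrix elements `⟪f j, A (e i)⟫`, in the two
orders of summation. Independence of the basis follows. -/
theorem hsNormSq_adjoint {ι κ : Type*} (e : HilbertBasis ι ℂ H) (f : HilbertBasis κ ℂ H)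
    (A : H →L[ℂ] H) : hsNormSq e A = hsNormSq f (adjoint A) := by
  unfold hsNormSq
  calc ∑' i, ENNReal.ofReal (‖A (e i)‖ ^ 2)
      = ∑' (i) (j), ENNReal.ofReal (‖⟪f j, A (e i)⟫_ℂ‖ ^ 2) :=
        tsum_congr fun i => (tsum_sq_norm_inner f _).symm
    _ = ∑' (j) (i), ENNReal.ofReal (‖⟪f j, A (e i)⟫_ℂ‖ ^ 2) := ENNReal.tsum_comm
    _ = _ := tsum_congr fun j => by
        rw [← tsum_sq_norm_inner e]
        refine tsum_congr fun i => ?_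
        rw [ContinuousLinearMap.adjoint_inner_right, norm_inner_symm]

theorem hsNormSq_eq {ι κ : Type*} (e : HilbertBasis ι ℂ H) (f : HilbertBasis κ ℂ H)
    (A : H →L[ℂ] H) : hsNormSq e A = hsNormSq f A := by
  rw [hsNormSq_adjoint e e, hsNormSq_adjoint e f, ContinuousLinearMap.adjoint_adjoint]

theorem hsNormSq_mul_left_le {ι : Type*} (e : HilbertBasis ι ℂ H) (A : H →L[ℂ] H)
    {W : H →L[ℂ] H} (hW : ‖W‖ ≤ 1) : hsNormSq e (W * A) ≤ hsNormSq e A := by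
  refine ENNReal.tsum_le_tsum fun i => ENNReal.ofReal_le_ofReal ?_
  gcongr
  exact (W.le_opNorm _).trans (mul_le_of_le_one_left (norm_nonneg _) hW)

theorem hsNormSq_mul_right_le {ι : Type*} (e : HilbertBasis ι ℂ H) (A : H →L[ℂ] H)
    {W : H →L[ℂ] H} (hW : ‖W‖ ≤ 1) : hsNormSq e (A * W) ≤ hsNormSq e A := by
  rw [hsNormSq_adjoint e e, hsNormSq_adjoint e e A, ← ContinuousLinearMap.star_eq_adjoint, star_mul]
  exact hsNormSq_mul_left_le e _ (by rwa [norm_star])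

/-- Young's inequality replaces Cauchy–Schwarz and so avoids square roots in `ℝ≥0∞`. The free weight
`t` is needed later, when one factor tends to zero and the other is merely bounded. -/
theorem two_mul_tsum_norm_inner_le {ι : Type*} (e : HilbertBasis ι ℂ H) (A B : H →L[ℂ] H)
    {t : ℝ} (ht : 0 < t) :
    2 * ∑' i, ENNReal.ofReal ‖⟪A (e i), B (e i)⟫_ℂ‖ ≤
      ENNReal.ofReal t * hsNormSq e A + ENNReal.ofReal t⁻¹ * hsNormSq e B := by
  unfold hsNormSq
  rw [← ENNReal.tsum_mul_left, ← ENNReal.tsum_mul_left, ← ENNReal.tsum_mul_left, ← ENNReal.tsum_add]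
  refine ENNReal.tsum_le_tsum fun i => ?_
  rw [← ENNReal.ofReal_mul ht.le, ← ENNReal.ofReal_mul (by positivity),
    ← ENNReal.ofReal_add (by positivity) (by positivity), ← ENNReal.ofReal_ofNat 2,
    ← ENNReal.ofReal_mul (by norm_num)]
  refine ENNReal.ofReal_le_ofReal ?_
  have h1 := norm_inner_le_norm (𝕜 := ℂ) (A (e i)) (B (e i))
  have h2 : 2 * (‖A (e i)‖ * ‖B (e i)‖) ≤ t * ‖A (e i)‖ ^ 2 + t⁻¹ * ‖B (e i)‖ ^ 2 := by
    have h3 : t * ‖A (e i)‖ ^ 2 + t⁻¹ * ‖B (e i)‖ ^ 2 - 2 * (‖A (e i)‖ * ‖B (e i)‖) =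
      t⁻¹ * (t * ‖A (e i)‖ - ‖B (e i)‖) ^ 2 := by
      field_simp
      ring
    have : 0 ≤ t⁻¹ * (t * ‖A (e i)‖ - ‖B (e i)‖) ^ 2 := by positivity
    linarith
  linarith

theorem norm_abs_apply (T : H →L[ℂ] H) (x : H) : ‖CFC.abs T x‖ = ‖T x‖ := by
  have hsa : IsSelfAdjoint (CFC.abs T) := (CFC.abs_nonneg T).isSelfAdjoint
  have h : ⟪CFC.abs T x, CFC.abs T x⟫_ℂ = ⟪T x, T x⟫_ℂ := by
    rw [← ContinuousLinearMap.adjoint_inner_right, ← ContinuousLinearMap.adjoint_inner_right,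
      ← ContinuousLinearMap.star_eq_adjoint, ← ContinuousLinearMap.star_eq_adjoint, hsa.star_eq,
      ← mul_apply_eq_comp, ← mul_apply_eq_comp, CFC.abs_mul_abs]
  rw [inner_self_eq_norm_sq_to_K, inner_self_eq_norm_sq_to_K] at h
  have h' : ‖CFC.abs T x‖ ^ 2 = ‖T x‖ ^ 2 := by exact_mod_cast h
  exact (pow_left_inj₀ (norm_nonneg _) (norm_nonneg _) two_ne_zero).1 h'

/-- Polar decomposition. -/
theorem exists_polar (T : H →L[ℂ] H) :
    ∃ U : H →L[ℂ] H, ‖U‖ ≤ 1 ∧ T = U * CFC.abs T ∧ CFC.abs T = star U * T := by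
  set P := CFC.abs T with hP
  have hsa : IsSelfAdjoint P := (CFC.abs_nonneg T).isSelfAdjoint
  set M := (LinearMap.range (P : H →ₗ[ℂ] H)).topologicalClosure with hM
  have hmem : ∀ x, P x ∈ M := fun x => Submodule.le_topologicalClosure _ ⟨x, rfl⟩
  set g : H →ₗ[ℂ] M := LinearMap.codRestrict M (P : H →ₗ[ℂ] H) hmem with hg
  have hdense : DenseRange g := by
    intro y
    rw [Metric.mem_closure_iff]
    intro ε hε
    obtain ⟨z, ⟨x, rfl⟩, hz⟩ := Metric.mem_closure_iff.1 y.2 ε hε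
    exact ⟨g x, ⟨x, rfl⟩, hz⟩
  have hnorm : ∀ x, ‖(T : H →ₗ[ℂ] H) x‖ ≤ 1 * ‖g x‖ := fun x => by
    rw [one_mul]
    exact (norm_abs_apply T x).ge
  have : CompleteSpace M :=
    (Submodule.isClosed_topologicalClosure _).completeSpace_coe
  -- The map `|T| x ↦ T x` is well defined and isometric because `‖|T| x‖ = ‖T x‖`; it extends to
  -- the closed range of `|T|`, and is then set to zero on the orthogonal complement.
  set V : M →L[ℂ] H := (T : H →ₗ[ℂ] H).extendOfNorm g with hV
  have hVg : ∀ x, V (g x) = T x := LinearMap.extendOfNorm_eq hdense ⟨1, hnorm⟩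
  have hVn : ‖V‖ ≤ 1 := LinearMap.opNorm_extendOfNorm_le hdense zero_le_one hnorm
  set U : H →L[ℂ] H := V ∘L M.orthogonalProjectionOnto with hU
  have hT : T = U * P := by
    ext x
    have : M.orthogonalProjectionOnto (P x) = g x := by
      ext
      exact Submodule.starProjection_eq_self_iff.2 (hmem x)
    rw [mul_apply_eq_comp, hU, ContinuousLinearMap.comp_apply, this, hVg]
  have hUn : ‖U‖ ≤ 1 := by
    refine (ContinuousLinearMap.opNorm_comp_le _ _).trans ?_
    exact mul_le_one₀ hVn (norm_nonneg _) M.orthogonalProjectionOnto_norm_le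
  refine ⟨U, hUn, hT, ?_⟩
  -- The range of `P - U† T` is orthogonal to the range of `P` by this identity, and it is contained
  -- in `M` because `U` vanishes on the complement of `M`. So the difference is zero.
  have h1 : P * (P - star U * T) = 0 := by
    have : P * star U = star T := by
      conv_rhs => rw [hT]
      rw [star_mul, hsa.star_eq]
    rw [mul_sub, ← mul_assoc, this, hP, CFC.abs_mul_abs, sub_self]
  ext x
  have hker : ∀ y, ⟪P y, (P - star U * T) x⟫_ℂ = 0 := fun y => by
    rw [← ContinuousLinearMap.adjoint_inner_right, ← ContinuousLinearMap.star_eq_adjoint,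
      hsa.star_eq, ← mul_apply_eq_comp, h1]
    simp
  have hperp : (P - star U * T) x ∈ Mᗮ := by
    rw [hM, Submodule.orthogonal_closure, Submodule.mem_orthogonal]
    rintro _ ⟨y, rfl⟩
    exact hker y
  have hin : (P - star U * T) x ∈ M := by
    refine M.sub_mem (hmem x) ?_
    rw [← Submodule.orthogonal_orthogonal M, Submodule.mem_orthogonal]
    intro z hz
    change ⟪z, (star U * T) x⟫_ℂ = 0
    rw [mul_apply_eq_comp, ContinuousLinearMap.star_eq_adjoint,
      ContinuousLinearMap.adjoint_inner_right, hU, ContinuousLinearMap.comp_apply,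
      (Submodule.orthogonalProjectionOnto_eq_zero_iff).2 hz]
    simp
  have h0 := Submodule.inner_right_of_mem_orthogonal hin hperp
  rw [inner_self_eq_zero, sub_apply, sub_eq_zero] at h0
  exact h0

theorem exists_sqrt {T : H →L[ℂ] H} (hT : T.IsPositive) :
    ∃ R : H →L[ℂ] H, IsSelfAdjoint R ∧ R * R = T := by
  have h : 0 ≤ T := (ContinuousLinearMap.nonneg_iff_isPositive T).2 hT
  exact ⟨CFC.sqrt T, (CFC.sqrt_nonneg T).isSelfAdjoint, CFC.sqrt_mul_sqrt_self T⟩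

theorem abs_isPositive (T : H →L[ℂ] H) : (CFC.abs T).IsPositive :=
  (ContinuousLinearMap.nonneg_iff_isPositive _).1 (CFC.abs_nonneg T)

theorem inner_mul_self_apply {R : H →L[ℂ] H} (hR : IsSelfAdjoint R) (x y : H) :
    ⟪x, (R * R) y⟫_ℂ = ⟪R x, R y⟫_ℂ := by
  rw [← ContinuousLinearMap.adjoint_inner_right, ← ContinuousLinearMap.star_eq_adjoint, hR.star_eq,
    mul_apply_eq_comp]

theorem re_inner_mul_self_apply {R : H →L[ℂ] H} (hR : IsSelfAdjoint R) (x : H) :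
    RCLike.re ⟪x, (R * R) x⟫_ℂ = ‖R x‖ ^ 2 := by
  rw [inner_mul_self_apply hR, inner_self_eq_norm_sq]

/-- The trace norm is the squared Hilbert–Schmidt norm of a square root of `|T|`, which frees it
from the chosen basis. -/
theorem traceNorm_eq_hsNormSq {ι : Type*} (e : HilbertBasis ι ℂ H) {T R : H →L[ℂ] H}
    (hR : IsSelfAdjoint R) (h : R * R = CFC.abs T) : traceNorm T = hsNormSq e R := by
  rw [hsNormSq_eq e (someBasis H)]
  unfold traceNorm hsNormSq
  simp_rw [← h, re_inner_mul_self_apply hR]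

theorem abs_of_isPositive {T : H →L[ℂ] H} (hT : T.IsPositive) : CFC.abs T = T :=
  CFC.abs_of_nonneg T ((ContinuousLinearMap.nonneg_iff_isPositive T).2 hT)

theorem traceNorm_of_isPositive {ι : Type*} (e : HilbertBasis ι ℂ H) {T : H →L[ℂ] H}
    (hT : T.IsPositive) :
    traceNorm T = ∑' i, ENNReal.ofReal (RCLike.re ⟪e i, T (e i)⟫_ℂ) := by
  obtain ⟨R, hR, h⟩ := exists_sqrt hT
  rw [traceNorm_eq_hsNormSq e hR (h.trans (abs_of_isPositive hT).symm), hsNormSq]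
  simp_rw [← h, re_inner_mul_self_apply hR]

/-- Writing `T = U R R` splits each term as `⟪R U† V eᵢ, R W eᵢ⟫`; contractions on the right do not
increase the Hilbert–Schmidt norm of `R`. Together with `exists_traceNorm_eq` this describes the
trace norm as a supremum over contractions, whence the triangle inequality and the ideal property.
-/
theorem tsum_norm_inner_le_traceNorm {ι : Type*} (e : HilbertBasis ι ℂ H) (T : H →L[ℂ] H)
    {V W : H →L[ℂ] H} (hV : ‖V‖ ≤ 1) (hW : ‖W‖ ≤ 1) :
    ∑' i, ENNReal.ofReal ‖⟪V (e i), T (W (e i))⟫_ℂ‖ ≤ traceNorm T := by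
  obtain ⟨U, hU, hT, -⟩ := exists_polar T
  obtain ⟨R, hR, h⟩ := exists_sqrt (abs_isPositive T)
  have hin : ∀ i, ⟪V (e i), T (W (e i))⟫_ℂ = ⟪(R * (star U * V)) (e i), (R * W) (e i)⟫_ℂ := by
    intro i
    simp only [mul_apply_eq_comp]
    rw [← inner_mul_self_apply hR, h, ContinuousLinearMap.star_eq_adjoint,
      ContinuousLinearMap.adjoint_inner_left, ← mul_apply_eq_comp U, ← hT]
  have key := two_mul_tsum_norm_inner_le e (R * (star U * V)) (R * W) one_pos
  simp_rw [← hin] at key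
  rw [inv_one, ENNReal.ofReal_one, one_mul, one_mul] at key
  have hUV : ‖star U * V‖ ≤ 1 :=
    (norm_mul_le _ _).trans (mul_le_one₀ (by rwa [norm_star]) (norm_nonneg _) hV)
  have h2 := key.trans (add_le_add (hsNormSq_mul_right_le e R hUV) (hsNormSq_mul_right_le e R hW))
  rw [← two_mul, ← traceNorm_eq_hsNormSq e hR h] at h2
  exact (ENNReal.mul_le_mul_iff_right two_ne_zero ENNReal.ofNat_ne_top).1 h2

theorem exists_traceNorm_eq (T : H →L[ℂ] H) : ∃ U : H →L[ℂ] H, ‖U‖ ≤ 1 ∧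
    traceNorm T ≤ ∑' i, ENNReal.ofReal ‖⟪U (someBasis H i), T (someBasis H i)⟫_ℂ‖ := by
  obtain ⟨U, hU, -, hT⟩ := exists_polar T
  refine ⟨U, hU, ENNReal.tsum_le_tsum fun i => ENNReal.ofReal_le_ofReal ?_⟩
  rw [hT, mul_apply_eq_comp, ContinuousLinearMap.star_eq_adjoint,
      ContinuousLinearMap.adjoint_inner_right]
  exact RCLike.re_le_norm _

theorem traceNorm_add_le (S T : H →L[ℂ] H) : traceNorm (S + T) ≤ traceNorm S + traceNorm T := by
  obtain ⟨U, hU, h⟩ := exists_traceNorm_eq (S + T)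
  have hid : ‖(1 : H →L[ℂ] H)‖ ≤ 1 := ContinuousLinearMap.norm_id_le
  refine h.trans (le_trans ?_ (add_le_add
    (tsum_norm_inner_le_traceNorm (someBasis H) S hU hid)
    (tsum_norm_inner_le_traceNorm (someBasis H) T hU hid)))
  rw [← ENNReal.tsum_add]
  refine ENNReal.tsum_le_tsum fun i => ?_
  rw [← ENNReal.ofReal_add (norm_nonneg _) (norm_nonneg _)]
  refine ENNReal.ofReal_le_ofReal ?_
  rw [add_apply, inner_add_right]
  exact norm_add_le _ _

theorem traceNorm_mul_mul_le (T : H →L[ℂ] H) {A B : H →L[ℂ] H} (hA : ‖A‖ ≤ 1) (hB : ‖B‖ ≤ 1) :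
    traceNorm (A * T * B) ≤ traceNorm T := by
  obtain ⟨U, hU, h⟩ := exists_traceNorm_eq (A * T * B)
  have hAU : ‖star A * U‖ ≤ 1 :=
    (norm_mul_le _ _).trans (mul_le_one₀ (by rwa [norm_star]) (norm_nonneg _) hU)
  refine h.trans (le_trans (le_of_eq ?_) (tsum_norm_inner_le_traceNorm (someBasis H) T hAU hB))
  refine tsum_congr fun i => ?_
  simp only [mul_apply_eq_comp, ContinuousLinearMap.star_eq_adjoint,
    ContinuousLinearMap.adjoint_inner_left]

theorem traceNorm_smul (c : ℂ) (T : H →L[ℂ] H) :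
    traceNorm (c • T) = ENNReal.ofReal ‖c‖ * traceNorm T := by
  unfold traceNorm
  rw [← ENNReal.tsum_mul_left]
  refine tsum_congr fun i => ?_
  rw [← ENNReal.ofReal_mul (norm_nonneg _), CFC.abs_smul, smul_apply,
    ← Complex.coe_smul, inner_smul_right]
  congr 1
  simp

theorem traceNorm_real_smul {c : ℝ} (hc : 0 ≤ c) (T : H →L[ℂ] H) :
    traceNorm (c • T) = ENNReal.ofReal c * traceNorm T := by
  have h := traceNorm_smul (c : ℂ) T
  rwa [Complex.coe_smul, Complex.norm_real, Real.norm_of_nonneg hc] at h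

theorem traceNorm_neg (T : H →L[ℂ] H) : traceNorm (-T) = traceNorm T := by
  rw [traceNorm, CFC.abs_neg, traceNorm]

@[simp] theorem traceNorm_zero : traceNorm (0 : H →L[ℂ] H) = 0 := by
  simp [traceNorm]

theorem traceNorm_sub_comm (S T : H →L[ℂ] H) : traceNorm (S - T) = traceNorm (T - S) := by
  rw [← traceNorm_neg, neg_sub]

theorem traceNorm_sub_le (S T R : H →L[ℂ] H) :
    traceNorm (S - R) ≤ traceNorm (S - T) + traceNorm (T - R) := by
  rw [← sub_add_sub_cancel S T R]
  exact traceNorm_add_le _ _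

theorem traceNorm_sum_le {α : Type*} (s : Finset α) (T : α → H →L[ℂ] H) :
    traceNorm (∑ a ∈ s, T a) ≤ ∑ a ∈ s, traceNorm (T a) :=
  Finset.le_sum_of_subadditive _ traceNorm_zero.le traceNorm_add_le s T

theorem norm_apply_sq_le_hsNormSq {ι : Type*} (e : HilbertBasis ι ℂ H) (A : H →L[ℂ] H) (x : H) :
    ENNReal.ofReal (‖A x‖ ^ 2) ≤ hsNormSq e A * ENNReal.ofReal (‖x‖ ^ 2) := by
  rw [hsNormSq_adjoint e e, hsNormSq, ← tsum_sq_norm_inner e, ← ENNReal.tsum_mul_right]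
  refine ENNReal.tsum_le_tsum fun i => ?_
  rw [← ENNReal.ofReal_mul (by positivity), ← mul_pow, ← ContinuousLinearMap.adjoint_inner_left]
  refine ENNReal.ofReal_le_ofReal ?_
  gcongr
  exact norm_inner_le_norm _ _

theorem ofReal_norm_inner_le_traceNorm (T : H →L[ℂ] H) (x y : H) (hx : ‖x‖ ≤ 1) (hy : ‖y‖ ≤ 1) :
    ENNReal.ofReal ‖⟪x, T y⟫_ℂ‖ ≤ traceNorm T := by
  obtain ⟨U, hU, hT, -⟩ := exists_polar T
  obtain ⟨R, hR, h⟩ := exists_sqrt (abs_isPositive T)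
  have hin : ⟪x, T y⟫_ℂ = ⟪R (star U x), R y⟫_ℂ := by
    rw [← inner_mul_self_apply hR, h, ContinuousLinearMap.star_eq_adjoint,
      ContinuousLinearMap.adjoint_inner_left, ← mul_apply_eq_comp U, ← hT]
  have hb : ∀ z : H, ‖z‖ ≤ 1 → ENNReal.ofReal (‖R z‖ ^ 2) ≤ traceNorm T := fun z hz => by
    rw [traceNorm_eq_hsNormSq (someBasis H) hR h]
    refine (norm_apply_sq_le_hsNormSq (someBasis H) R z).trans ?_
    refine mul_le_of_le_one_right zero_le ?_
    rw [ENNReal.ofReal_le_one]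
    exact pow_le_one₀ (norm_nonneg _) hz
  have hUx : ‖star U x‖ ≤ 1 := ((star U).le_opNorm x).trans
    (mul_le_one₀ (by rwa [norm_star]) (norm_nonneg _) hx)
  have h3 : ENNReal.ofReal (2 * ‖⟪x, T y⟫_ℂ‖) ≤ traceNorm T + traceNorm T := by
    refine le_trans ?_ (add_le_add (hb _ hUx) (hb _ hy))
    rw [← ENNReal.ofReal_add (by positivity) (by positivity), hin]
    refine ENNReal.ofReal_le_ofReal ?_
    have := norm_inner_le_norm (𝕜 := ℂ) (R (star U x)) (R y)
    nlinarith [sq_nonneg (‖R (star U x)‖ - ‖R y‖)]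
  rw [ENNReal.ofReal_mul (by norm_num), ENNReal.ofReal_ofNat, ← two_mul] at h3
  exact (ENNReal.mul_le_mul_iff_right two_ne_zero ENNReal.ofNat_ne_top).1 h3

theorem ofReal_norm_inner_le (T : H →L[ℂ] H) (x y : H) :
    ENNReal.ofReal ‖⟪x, T y⟫_ℂ‖ ≤ ENNReal.ofReal (‖x‖ * ‖y‖) * traceNorm T := by
  rcases eq_or_ne x 0 with rfl | hx
  · simp
  rcases eq_or_ne y 0 with rfl | hy
  · simp
  have h := ofReal_norm_inner_le_traceNorm T (((‖x‖⁻¹ : ℝ) : ℂ) • x) (((‖y‖⁻¹ : ℝ) : ℂ) • y)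
    (by simp [norm_smul, hx]) (by simp [norm_smul, hy])
  have hx' := norm_pos_iff.2 hx
  have hy' := norm_pos_iff.2 hy
  calc ENNReal.ofReal ‖⟪x, T y⟫_ℂ‖
      = ENNReal.ofReal (‖x‖ * ‖y‖) * ENNReal.ofReal
          ‖⟪((‖x‖⁻¹ : ℝ) : ℂ) • x, T (((‖y‖⁻¹ : ℝ) : ℂ) • y)⟫_ℂ‖ := by
        rw [← ENNReal.ofReal_mul (by positivity)]
        congr 1
        simp only [map_smul, inner_smul_left, inner_smul_right, norm_mul, RCLike.norm_conj,
          Complex.norm_real, norm_inv, norm_norm]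
        field_simp
    _ ≤ _ := by gcongr

theorem eq_zero_of_traceNorm_eq_zero {T : H →L[ℂ] H} (h : traceNorm T = 0) : T = 0 := by
  ext x
  have h1 := ofReal_norm_inner_le T (T x) x
  rw [h, mul_zero, nonpos_iff_eq_zero, ENNReal.ofReal_eq_zero] at h1
  have := norm_le_zero_iff.1 h1
  simpa using this

theorem traceNorm_rankOne_le {x y : H} (hx : ‖x‖ ≤ 1) (hy : ‖y‖ ≤ 1) :
    traceNorm (InnerProductSpace.rankOne ℂ x y) ≤ 1 := by
  obtain ⟨U, hU, h⟩ := exists_traceNorm_eq (InnerProductSpace.rankOne ℂ x y)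
  have h2 : 2 * traceNorm (InnerProductSpace.rankOne ℂ x y) ≤ 2 * 1 := by
    calc 2 * traceNorm (InnerProductSpace.rankOne ℂ x y)
        ≤ 2 * ∑' i, ENNReal.ofReal
          ‖⟪U (someBasis H i), InnerProductSpace.rankOne ℂ x y (someBasis H i)⟫_ℂ‖ := by gcongr
      _ ≤ ENNReal.ofReal (‖adjoint U x‖ ^ 2) + ENNReal.ofReal (‖y‖ ^ 2) := by
        rw [← tsum_sq_norm_inner (someBasis H), ← tsum_sq_norm_inner (someBasis H) y,
          ← ENNReal.tsum_add, ← ENNReal.tsum_mul_left]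
        refine ENNReal.tsum_le_tsum fun i => ?_
        rw [← ENNReal.ofReal_add (by positivity) (by positivity), ← ENNReal.ofReal_ofNat 2,
          ← ENNReal.ofReal_mul (by norm_num)]
        refine ENNReal.ofReal_le_ofReal ?_
        rw [InnerProductSpace.rankOne_apply, inner_smul_right, norm_mul,
          ContinuousLinearMap.adjoint_inner_right, norm_inner_symm y]
        nlinarith [sq_nonneg (‖⟪U (someBasis H i), x⟫_ℂ‖ - ‖⟪someBasis H i, y⟫_ℂ‖)]
      _ ≤ 1 + 1 := by
        refine add_le_add ?_ ?_
        · rw [ENNReal.ofReal_le_one]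
          refine pow_le_one₀ (norm_nonneg _) (((adjoint U).le_opNorm x).trans
            (mul_le_one₀ ?_ (norm_nonneg _) hx))
          rwa [← ContinuousLinearMap.star_eq_adjoint, norm_star]
        · rw [ENNReal.ofReal_le_one]
          exact pow_le_one₀ (norm_nonneg _) hy
      _ = 2 * 1 := by norm_num
  exact (ENNReal.mul_le_mul_iff_right two_ne_zero ENNReal.ofNat_ne_top).1 h2

theorem traceNorm_rankOne_self (x : H) :
    traceNorm (InnerProductSpace.rankOne ℂ x x) = ENNReal.ofReal (‖x‖ ^ 2) := by
  rw [traceNorm_of_isPositive (someBasis H) (InnerProductSpace.isPositive_rankOne_self x),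
    ← tsum_sq_norm_inner (someBasis H)]
  refine tsum_congr fun i => ?_
  congr 1
  rw [InnerProductSpace.rankOne_apply, inner_smul_right, ← inner_conj_symm,
    ← Complex.normSq_eq_conj_mul_self, Complex.normSq_eq_norm_sq]
  exact Complex.ofReal_re _

theorem traceNorm_add_of_isPositive {S T : H →L[ℂ] H} (hS : S.IsPositive) (hT : T.IsPositive) :
    traceNorm (S + T) = traceNorm S + traceNorm T := by
  rw [traceNorm_of_isPositive (someBasis H) hS, traceNorm_of_isPositive (someBasis H) hT,
    traceNorm_of_isPositive (someBasis H) (hS.add hT), ← ENNReal.tsum_add]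
  refine tsum_congr fun i => ?_
  rw [← ENNReal.ofReal_add (hS.re_inner_nonneg_right _) (hT.re_inner_nonneg_right _),
    add_apply, inner_add_right, map_add]

theorem isPositive_real_smul {T : H →L[ℂ] H} (hT : T.IsPositive) {c : ℝ} (hc : 0 ≤ c) :
    (c • T).IsPositive := by
  rw [← Complex.coe_smul]
  exact hT.smul_of_nonneg (by exact_mod_cast hc)

theorem inner_eq_re_of_isPositive {T : H →L[ℂ] H} (hT : T.IsPositive) (x : H) :
    ⟪x, T x⟫_ℂ = ((RCLike.re ⟪x, T x⟫_ℂ : ℝ) : ℂ) := by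
  have h := hT.inner_nonneg_right x
  rw [RCLike.nonneg_iff] at h
  exact Complex.ext (by simp) (by simpa using h.2)

theorem trace_of_isPositive {T : H →L[ℂ] H} (hT : T.IsPositive) :
    trace T = (traceNorm T).toReal := by
  rw [traceNorm_of_isPositive (someBasis H) hT, ENNReal.tsum_toReal_eq
    (fun _ => ENNReal.ofReal_ne_top), Complex.ofReal_tsum, trace]
  refine tsum_congr fun i => ?_
  rw [ENNReal.toReal_ofReal (hT.re_inner_nonneg_right _)]
  exact inner_eq_re_of_isPositive hT _

/-- For positive operators the trace is the real number underlying the trace norm, so normalisation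
can be handled in `ℝ≥0∞`. -/
theorem isState_iff {ρ : H →L[ℂ] H} : IsState ρ ↔ ρ.IsPositive ∧ traceNorm ρ = 1 := by
  constructor
  · rintro ⟨h1, h2, h3⟩
    refine ⟨h1, ?_⟩
    rw [trace_of_isPositive h1] at h3
    have h4 : (traceNorm ρ).toReal = 1 := by exact_mod_cast h3
    rwa [ENNReal.toReal_eq_one_iff] at h4
  · rintro ⟨h1, h2⟩
    refine ⟨h1, ?_, ?_⟩
    · rw [IsTraceClass, h2]
      exact ENNReal.one_lt_top
    · rw [trace_of_isPositive h1, h2]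
      simp

/-- With compactness of rank-one operators, this makes matrix elements weak*-continuous. -/
theorem trace_mul_rankOne (T : H →L[ℂ] H) (x y : H) :
    trace (T * InnerProductSpace.rankOne ℂ x y) = ⟪y, T x⟫_ℂ := by
  rw [← (someBasis H).tsum_inner_mul_inner y (T x), trace]
  refine tsum_congr fun i => ?_
  rw [mul_apply_eq_comp, InnerProductSpace.rankOne_apply, map_smul, inner_smul_right]

theorem isCompactOperator_rankOne (x y : H) :
    IsCompactOperator (InnerProductSpace.rankOne ℂ x y) := by
  rw [InnerProductSpace.rankOne_def']
  have h : IsCompactOperator (id : ℂ → ℂ) :=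
    (isCompactOperator_id_iff_finiteDimensional (𝕜 := ℂ)).2 inferInstance
  exact (h.comp_clm (innerSL ℂ y)).clm_comp (ContinuousLinearMap.toSpanSingleton ℂ x)

end TraceNorm

/-! ### Finite-rank basis projections and approximation by compressions. -/

section BasisProjection

open ContinuousLinearMap (adjoint)
open Filter

variable {H : Type*} [NormedAddCommGroup H] [InnerProductSpace ℂ H] [CompleteSpace H]
  {ι : Type*} (e : HilbertBasis ι ℂ H)

theorem inner_basis_basis [DecidableEq ι] (i j : ι) : ⟪e i, e j⟫_ℂ = if i = j then 1 else 0 :=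
  orthonormal_iff_ite.1 e.orthonormal i j

theorem ext_inner_basis {x y : H} (h : ∀ i, ⟪e i, x⟫_ℂ = ⟪e i, y⟫_ℂ) : x = y := by
  apply e.repr.injective
  ext i
  rw [e.repr_apply_apply, e.repr_apply_apply, h]

/-- The orthogonal projection onto the span of finitely many basis vectors. -/
def basisProj (A : Finset ι) : H →L[ℂ] H := ∑ a ∈ A, InnerProductSpace.rankOne ℂ (e a) (e a)

theorem basisProj_apply (A : Finset ι) (x : H) :
    basisProj e A x = ∑ a ∈ A, ⟪e a, x⟫_ℂ • e a := by
  simp [basisProj]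

theorem star_basisProj (A : Finset ι) : star (basisProj e A) = basisProj e A := by
  simp [basisProj, star_sum, ContinuousLinearMap.star_eq_adjoint]

theorem inner_basisProj [DecidableEq ι] (A : Finset ι) (x : H) (i : ι) :
    ⟪e i, basisProj e A x⟫_ℂ = if i ∈ A then ⟪e i, x⟫_ℂ else 0 := by
  rw [basisProj_apply, inner_sum]
  simp_rw [inner_smul_right, inner_basis_basis e, mul_ite, mul_one, mul_zero]
  rw [Finset.sum_ite_eq]

theorem basisProj_basis [DecidableEq ι] (A : Finset ι) (i : ι) :
    basisProj e A (e i) = if i ∈ A then e i else 0 := by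
  rw [basisProj_apply]
  simp_rw [inner_basis_basis e, ite_smul, one_smul, zero_smul]
  rw [Finset.sum_ite_eq']

theorem norm_basisProj_le (A : Finset ι) : ‖basisProj e A‖ ≤ 1 := by
  classical
  refine ContinuousLinearMap.opNorm_le_bound _ zero_le_one fun x => ?_
  rw [one_mul, ← pow_le_pow_iff_left₀ (norm_nonneg _) (norm_nonneg _) two_ne_zero,
    ← ENNReal.ofReal_le_ofReal_iff (by positivity), ← tsum_sq_norm_inner e,
    ← tsum_sq_norm_inner e]
  refine ENNReal.tsum_le_tsum fun i => ENNReal.ofReal_le_ofReal ?_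
  rw [inner_basisProj]
  split_ifs
  · exact le_rfl
  · simp

theorem tendsto_basisProj (x : H) : Tendsto (fun A => basisProj e A x) atTop (𝓝 x) := by
  simp_rw [basisProj_apply, ← e.repr_apply_apply]
  exact e.hasSum_repr x

theorem tendsto_hsNormSq_mul_one_sub {R : H →L[ℂ] H} (hR : hsNormSq e R ≠ ∞) :
    Tendsto (fun A => hsNormSq e (R * (1 - basisProj e A))) atTop (𝓝 0) := by
  classical
  have h := ENNReal.tendsto_tsum_compl_atTop_zero hR
  refine h.congr fun A => ?_
  change ∑' b : {x | x ∉ A}, ENNReal.ofReal (‖R (e b)‖ ^ 2) = _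
  rw [tsum_subtype {x | x ∉ A} fun b => ENNReal.ofReal (‖R (e b)‖ ^ 2), hsNormSq]
  refine tsum_congr fun i => ?_
  by_cases hi : i ∈ A <;> simp [mul_apply_eq_comp, sub_apply, basisProj_basis, hi]

/-- Weighted form of `‖AB‖₁ ≤ ‖A‖₂ ‖B‖₂`. -/
theorem two_mul_traceNorm_mul_le (A B : H →L[ℂ] H) {t : ℝ} (ht : 0 < t) :
    2 * traceNorm (A * B) ≤
      ENNReal.ofReal t * hsNormSq e (star A) + ENNReal.ofReal t⁻¹ * hsNormSq e B := by
  obtain ⟨U, hU, h⟩ := exists_traceNorm_eq (A * B)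
  have hin : ∀ i, ⟪U (someBasis H i), (A * B) (someBasis H i)⟫_ℂ =
      ⟪(star A * U) (someBasis H i), B (someBasis H i)⟫_ℂ := fun i => by
    rw [mul_apply_eq_comp, mul_apply_eq_comp, ContinuousLinearMap.star_eq_adjoint,
      ContinuousLinearMap.adjoint_inner_left]
  simp_rw [hin] at h
  calc 2 * traceNorm (A * B) ≤ 2 * _ := by gcongr
    _ ≤ ENNReal.ofReal t * hsNormSq (someBasis H) (star A * U) +
      ENNReal.ofReal t⁻¹ * hsNormSq (someBasis H) B := two_mul_tsum_norm_inner_le _ _ _ ht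
    _ ≤ ENNReal.ofReal t * hsNormSq (someBasis H) (star A) +
      ENNReal.ofReal t⁻¹ * hsNormSq (someBasis H) B := by
        gcongr
        exact hsNormSq_mul_right_le _ _ hU
    _ = _ := by rw [hsNormSq_eq (someBasis H) e, hsNormSq_eq (someBasis H) e]

/-- Compressions to finitely many basis vectors approximate a positive trace-class operator in the
trace norm. -/
theorem tendsto_traceNorm_sub_compression {T : H →L[ℂ] H} (hT : T.IsPositive)
    (hT' : IsTraceClass T) :
    Tendsto (fun A => traceNorm (T - basisProj e A * T * basisProj e A)) atTop (𝓝 0) := by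
  obtain ⟨R, hR, rfl⟩ := exists_sqrt hT
  have hRn : hsNormSq e R ≠ ∞ := by
    rw [← traceNorm_eq_hsNormSq e hR (abs_of_isPositive hT).symm]
    exact hT'.ne
  have key : ∀ t : ℝ, 0 < t → ∀ A, traceNorm (R * R - basisProj e A * (R * R) * basisProj e A) ≤
      ENNReal.ofReal t * hsNormSq e (R * (1 - basisProj e A)) +
        ENNReal.ofReal t⁻¹ * hsNormSq e R := by
    intro t ht A
    set Q := basisProj e A with hQ
    have hQs : star Q = Q := star_basisProj e A
    have h1 := two_mul_traceNorm_mul_le e ((1 - Q) * R) R ht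
    have h2 := two_mul_traceNorm_mul_le e (Q * R) (R * (1 - Q)) (inv_pos.2 ht)
    rw [star_mul, star_sub, star_one, hQs, hR.star_eq] at h1
    rw [star_mul, hQs, hR.star_eq, inv_inv] at h2
    have h3 : hsNormSq e (R * Q) ≤ hsNormSq e R :=
      hsNormSq_mul_right_le e R (norm_basisProj_le e A)
    -- Each summand contains `R (1 - Q)` or its adjoint, whose Hilbert–Schmidt norm is the tail of a
    -- convergent series; the other factor is bounded by `‖R‖₂`.
    have h4 : R * R - Q * (R * R) * Q = (1 - Q) * R * R + Q * R * (R * (1 - Q)) := by noncomm_ring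
    rw [h4]
    refine (ENNReal.mul_le_mul_iff_right two_ne_zero ENNReal.ofNat_ne_top).1 ?_
    calc 2 * traceNorm ((1 - Q) * R * R + Q * R * (R * (1 - Q)))
        ≤ 2 * (traceNorm ((1 - Q) * R * R) + traceNorm (Q * R * (R * (1 - Q)))) := by
          gcongr
          exact traceNorm_add_le _ _
      _ ≤ (ENNReal.ofReal t * hsNormSq e (R * (1 - Q)) + ENNReal.ofReal t⁻¹ * hsNormSq e R) +
          (ENNReal.ofReal t⁻¹ * hsNormSq e R + ENNReal.ofReal t * hsNormSq e (R * (1 - Q))) := by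
          rw [mul_add]
          refine add_le_add h1 (h2.trans ?_)
          gcongr
      _ = _ := by ring
  have h0 := tendsto_hsNormSq_mul_one_sub e hRn
  rw [ENNReal.tendsto_nhds_zero]
  intro ε hε
  rcases eq_or_ne ε ∞ with rfl | hεt
  · exact Eventually.of_forall fun _ => le_top
  have hε2 : 0 < ε / 2 := ENNReal.half_pos hε.ne'
  have hlim : Tendsto (fun t : ℝ => ENNReal.ofReal t⁻¹ * hsNormSq e R) atTop (𝓝 0) := by
    have h5 : Tendsto (fun t : ℝ => ENNReal.ofReal t⁻¹) atTop (𝓝 0) := by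
      simpa [Function.comp_def] using
        (ENNReal.continuous_ofReal.tendsto 0).comp tendsto_inv_atTop_zero
    simpa using ENNReal.Tendsto.mul_const h5 (Or.inr hRn)
  -- First `t` is taken large to make the bounded part small; only then does the finite set grow.
  obtain ⟨t, ht1, ht2⟩ := ((ENNReal.tendsto_nhds_zero.1 hlim _ hε2).and
    (eventually_gt_atTop 0)).exists
  have h6 : Tendsto (fun A => ENNReal.ofReal t * hsNormSq e (R * (1 - basisProj e A))) atTop
      (𝓝 0) := by
    simpa using ENNReal.Tendsto.const_mul h0 (Or.inr ENNReal.ofReal_ne_top)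
  filter_upwards [ENNReal.tendsto_nhds_zero.1 h6 _ hε2] with A hA
  calc _ ≤ _ := key t ht2 A
    _ ≤ ε / 2 + ε / 2 := add_le_add hA ht1
    _ = ε := ENNReal.add_halves ε

/-- The finite-rank operators `R Q` converge to `R` in operator norm, which is dominated by the
Hilbert–Schmidt norm. -/
theorem isCompactOperator_of_hsNormSq_ne_top {R : H →L[ℂ] H} (hR : hsNormSq e R ≠ ∞) :
    IsCompactOperator R := by
  have hfin : ∀ A, IsCompactOperator (R * basisProj e A) := by
    intro A
    have : ∀ B : Finset ι, IsCompactOperator (basisProj e B) := by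
      classical
      intro B
      induction B using Finset.induction_on with
      | empty => simpa [basisProj] using isCompactOperator_zero
      | insert a B ha ih =>
        rw [basisProj, Finset.sum_insert ha]
        exact (isCompactOperator_rankOne _ _).add ih
    exact (this A).clm_comp R
  refine isCompactOperator_of_tendsto (F := fun A => R * basisProj e A) (l := atTop) ?_
    (Eventually.of_forall hfin)
  rw [tendsto_iff_norm_sub_tendsto_zero]
  have h0 := tendsto_hsNormSq_mul_one_sub e hR
  have h1 : Tendsto (fun A => Real.sqrt (hsNormSq e (R * (1 - basisProj e A))).toReal) atTop
      (𝓝 0) := by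
    have := (Real.continuous_sqrt.tendsto _).comp 
      ((ENNReal.tendsto_toReal ENNReal.zero_ne_top).comp h0)
    simpa [Function.comp_def] using this
  refine squeeze_zero (fun _ => norm_nonneg _) (fun A => ?_) h1
  rw [norm_sub_rev]
  have hfin' : hsNormSq e (R * (1 - basisProj e A)) ≠ ∞ := by
    refine ne_top_of_le_ne_top hR (ENNReal.tsum_le_tsum fun i => ENNReal.ofReal_le_ofReal ?_)
    classical
    by_cases hi : i ∈ A <;> simp [mul_apply_eq_comp, sub_apply, basisProj_basis, hi]
  refine ContinuousLinearMap.opNorm_le_bound _ (Real.sqrt_nonneg _) fun x => ?_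
  have h2 := norm_apply_sq_le_hsNormSq e (R * (1 - basisProj e A)) x
  have h3 : ‖(R * (1 - basisProj e A)) x‖ ^ 2 ≤
      (hsNormSq e (R * (1 - basisProj e A))).toReal * ‖x‖ ^ 2 := by
    have h4 := ENNReal.toReal_mono (ENNReal.mul_ne_top hfin' ENNReal.ofReal_ne_top) h2
    rwa [ENNReal.toReal_mul, ENNReal.toReal_ofReal (by positivity),
      ENNReal.toReal_ofReal (by positivity)] at h4
  have h5 := Real.sqrt_le_sqrt h3
  rw [Real.sqrt_mul ENNReal.toReal_nonneg, Real.sqrt_sq (norm_nonneg _),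
    Real.sqrt_sq (norm_nonneg _)] at h5
  rwa [show R - R * basisProj e A = R * (1 - basisProj e A) by rw [mul_sub, mul_one]]

end BasisProjection

/-! ### Spectral decompositions of positive trace-class operators. -/

section Spectral

variable {H : Type*} [NormedAddCommGroup H] [InnerProductSpace ℂ H] [CompleteSpace H]

theorem isCompactOperator_of_isTraceClass {T : H →L[ℂ] H} (hT : T.IsPositive)
    (hT' : IsTraceClass T) : IsCompactOperator T := by
  obtain ⟨R, hR, rfl⟩ := exists_sqrt hT
  have hRn : hsNormSq (someBasis H) R ≠ ∞ := by
    rw [← traceNorm_eq_hsNormSq _ hR (abs_of_isPositive hT).symm]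
    exact hT'.ne
  exact (isCompactOperator_of_hsNormSq_ne_top _ hRn).clm_comp R

/-- Such an operator is compact and self-adjoint, so its eigenspaces, the kernel included, span a
dense subspace; Hilbert bases of the eigenspaces are glued together. -/
theorem exists_spectralDecomposition {T : H →L[ℂ] H} (hT : T.IsPositive)
    (hT' : IsTraceClass T) : ∃ (s : Set H) (e : HilbertBasis s ℂ H) (x : s → ℝ),
      IsSpectralDecomposition T e x := by
  have hc := isCompactOperator_of_isTraceClass hT hT'
  have hbot := ContinuousLinearMap.orthogonalComplement_iSup_eigenspaces_eq_bot hc hT.isSymmetric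
  let E : ℂ → Submodule ℂ H := fun μ => Module.End.eigenspace (T : Module.End ℂ H) μ
  have hE : ∀ μ, IsClosed (E μ : Set H) := by
    intro μ
    have : (E μ : Set H) = {v | T v = μ • v} := by
      ext v
      exact Module.End.mem_eigenspace_iff
    rw [this]
    exact isClosed_eq T.continuous (continuous_const_smul μ)
  have : ∀ μ, CompleteSpace (E μ) := fun μ => (hE μ).completeSpace_coe
  choose w b hb using fun μ => exists_hilbertBasis ℂ (E μ)
  have hfam : OrthogonalFamily ℂ (fun μ => E μ) fun μ => (E μ).subtypeₗᵢ :=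
    LinearMap.IsSymmetric.orthogonalFamily_eigenspaces hT.isSymmetric
  have hon := hfam.orthonormal_sigma_orthonormal fun μ => (b μ).orthonormal
  have hcompl : (Submodule.span ℂ (Set.range fun a : Σ μ, w μ =>
      (E a.1).subtypeₗᵢ (b a.1 a.2)))ᗮ = ⊥ := by
    rw [eq_bot_iff, ← hbot]
    intro v hv
    rw [← Submodule.iInf_orthogonal, Submodule.mem_iInf]
    intro μ
    change v ∈ (E μ)ᗮ
    rw [← Submodule.orthogonalProjectionOnto_eq_zero_iff]
    refine ext_inner_basis (b μ) fun i => ?_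
    rw [inner_zero_right, Submodule.inner_orthogonalProjectionOnto_eq_of_mem_left]
    exact Submodule.mem_orthogonal _ _ |>.1 hv _ (Submodule.subset_span ⟨⟨μ, i⟩, rfl⟩)
  -- The index runs over all complex `μ`. An eigenvalue with an actual eigenvector is real by
  -- positivity, so taking its real part loses nothing.
  refine IsSpectralDecomposition.exists_set (e := HilbertBasis.mkOfOrthogonalEqBot hon hcompl)
    (x := fun a => a.1.re) fun a => ?_
  rw [HilbertBasis.coe_mkOfOrthogonalEqBot]
  have h1 : T (b a.1 a.2 : H) = a.1 • (b a.1 a.2 : H) :=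
    Module.End.mem_eigenspace_iff.1 (b a.1 a.2).2
  have h2 : ⟪(b a.1 a.2 : H), (b a.1 a.2 : H)⟫_ℂ = 1 := by
    have := (b a.1).orthonormal.1 a.2
    rw [Submodule.coe_norm] at this
    rw [inner_self_eq_norm_sq_to_K, this]
    simp
  have h3 := inner_eq_re_of_isPositive hT (b a.1 a.2 : H)
  rw [h1, inner_smul_right, h2, mul_one] at h3
  change T (b a.1 a.2 : H) = (a.1.re : ℂ) • (b a.1 a.2 : H)
  rw [h1]
  congr 1

theorem IsSpectralDecomposition.nonneg {ι : Type*} {T : H →L[ℂ] H} {e : HilbertBasis ι ℂ H}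
    {x : ι → ℝ} (h : IsSpectralDecomposition T e x) (hT : T.IsPositive) (i : ι) : 0 ≤ x i := by
  classical
  have h1 := hT.re_inner_nonneg_right (e i)
  rw [h i, inner_smul_right, inner_basis_basis e] at h1
  simpa using h1

theorem IsSpectralDecomposition.tsum_eq_traceNorm {ι : Type*} {T : H →L[ℂ] H}
    {e : HilbertBasis ι ℂ H} {x : ι → ℝ} (h : IsSpectralDecomposition T e x) (hT : T.IsPositive) :
    ∑' i, ENNReal.ofReal (x i) = traceNorm T := by
  classical
  rw [traceNorm_of_isPositive e hT]
  refine tsum_congr fun i => ?_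
  rw [h i, inner_smul_right, inner_basis_basis e]
  simp

end Spectral

/-! ### Product bases and product projections on Hilbert tensor products. -/

section TensorBasis

open Filter

variable {ι : Type*} [Fintype ι] {E : ι → Type*} [∀ i, NormedAddCommGroup (E i)]
  [∀ i, InnerProductSpace ℂ (E i)]

theorem ext_inner_tmul {u v : HTensor E} (h : ∀ x, ⟪tmul x, u⟫_ℂ = ⟪tmul x, v⟫_ℂ) : u = v := by
  refine dense_span_tmul.eq_of_inner_right ℂ fun w hw => ?_
  refine Submodule.span_induction (p := fun w _ => ⟪w, u⟫_ℂ = ⟪w, v⟫_ℂ) ?_ ?_ ?_ ?_ hw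
  · rintro _ ⟨x, rfl⟩
    exact h x
  · simp
  · intro a b _ _ ha hb
    rw [inner_add_left, inner_add_left, ha, hb]
  · intro a b _ hb
    rw [inner_smul_left, inner_smul_left, hb]

theorem norm_tmul (x : ∀ i, E i) : ‖tmul x‖ = ∏ i, ‖x i‖ := by
  have h := inner_tmul x x
  simp_rw [inner_self_eq_norm_sq_to_K] at h
  have h' : ‖tmul x‖ ^ 2 = (∏ i, ‖x i‖) ^ 2 := by
    rw [← Finset.prod_pow]
    exact_mod_cast h
  exact (pow_left_inj₀ (norm_nonneg _) (Finset.prod_nonneg fun _ _ => norm_nonneg _)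
    two_ne_zero).1 h'

/-- Expanding `‖⊗y - ⊗x‖²` through `inner_tmul` gives a continuous function of `y` that vanishes at
`x`; no multilinear estimate is needed. -/
theorem continuous_tmul : Continuous (tmul : (∀ i, E i) → HTensor E) := by
  rw [continuous_iff_continuousAt]
  intro x
  have h : ∀ y, ‖tmul y - tmul x‖ ^ 2 =
      ‖tmul y‖ ^ 2 - 2 * (∏ i, ⟪y i, x i⟫_ℂ).re + ‖tmul x‖ ^ 2 := fun y => by
    rw [@norm_sub_sq ℂ, inner_tmul]
    rfl
  have hc : Continuous fun y : ∀ i, E i =>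
      ‖tmul y‖ ^ 2 - 2 * (∏ i, ⟪y i, x i⟫_ℂ).re + ‖tmul x‖ ^ 2 := by
    simp_rw [norm_tmul]
    refine .add (.sub (by fun_prop) (continuous_const.mul (Complex.continuous_re.comp ?_)))
      continuous_const
    exact continuous_finsetProd _ fun i _ => (continuous_apply i).inner continuous_const
  simp_rw [← h] at hc
  have h0 := hc.tendsto x
  rw [sub_self, norm_zero, zero_pow two_ne_zero] at h0
  have h1 := (Real.continuous_sqrt.tendsto 0).comp h0
  rw [Real.sqrt_zero] at h1
  rw [ContinuousAt, tendsto_iff_norm_sub_tendsto_zero]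
  refine h1.congr fun y => ?_
  rw [Function.comp_apply, Real.sqrt_sq (norm_nonneg _)]

instance [∀ i, TopologicalSpace.SeparableSpace (E i)] :
    TopologicalSpace.SeparableSpace (HTensor E) := by
  have h1 : TopologicalSpace.IsSeparable (Set.range (tmul : (∀ i, E i) → HTensor E)) :=
    TopologicalSpace.isSeparable_range continuous_tmul
  have h2 := (h1.span (R := ℂ)).closure
  rw [dense_span_tmul.closure_eq] at h2
  exact TopologicalSpace.isSeparable_univ_iff.1 h2

variable [DecidableEq ι] [∀ i, CompleteSpace (E i)] {κ : ι → Type*}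
  (e : ∀ i, HilbertBasis (κ i) ℂ (E i))

/-- Distributing the product over the sums shows that projecting onto a box of product vectors is
the same as projecting each factor. -/
theorem sum_tmul_basis (F : ∀ i, Finset (κ i)) (x : ∀ i, E i) :
    ∑ a ∈ Fintype.piFinset F, ⟪tmul fun i => e i (a i), tmul x⟫_ℂ • tmul (fun i => e i (a i)) =
      tmul fun i => basisProj (e i) (F i) (x i) := by
  refine ext_inner_tmul fun y => ?_
  rw [inner_sum]
  simp_rw [inner_smul_right, inner_tmul, basisProj_apply, inner_sum, inner_smul_right]
  rw [Finset.prod_univ_sum]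
  refine Finset.sum_congr rfl fun a _ => ?_
  rw [Finset.prod_mul_distrib]

theorem tendsto_tmul_basisProj (x : ∀ i, E i) :
    Tendsto (fun F : ∀ i, Finset (κ i) => tmul fun i => basisProj (e i) (F i) (x i)) atTop
      (𝓝 (tmul x)) := by
  refine (continuous_tmul.tendsto x).comp (tendsto_pi_nhds.2 fun i => ?_)
  exact (tendsto_basisProj (e i) (x i)).comp
    (tendsto_atTop_atTop_of_monotone (Function.monotone_eval i) fun b =>
      ⟨Function.update (fun _ => ∅) i b, by simp⟩)

/-- The product basis of a Hilbert tensor product. -/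
def tensorBasis : HilbertBasis (∀ i, κ i) ℂ (HTensor E) :=
  HilbertBasis.mkOfOrthogonalEqBot (v := fun a => tmul fun i => e i (a i))
    (by
      classical
      rw [orthonormal_iff_ite]
      intro a b
      simp_rw [inner_tmul, inner_basis_basis]
      split_ifs with h
      · simp [h]
      · obtain ⟨i, hi⟩ := Function.ne_iff.1 h
        exact Finset.prod_eq_zero (Finset.mem_univ i) (by simp [hi]))
    (by
      classical
      rw [eq_bot_iff]
      intro v hv
      rw [Submodule.mem_bot]
      refine ext_inner_tmul fun x => ?_
      rw [inner_zero_right]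
      -- A vector orthogonal to all product basis vectors is orthogonal to `⊗ Qᵢ xᵢ` for finite
      -- basis projections `Qᵢ`, hence in the limit to `⊗ xᵢ`.
      refine tendsto_nhds_unique
        ((tendsto_tmul_basisProj e x).inner (tendsto_const_nhds (x := v))) ?_
      refine tendsto_const_nhds.congr fun F => ?_
      rw [← sum_tmul_basis, sum_inner]
      refine (Finset.sum_eq_zero fun a _ => ?_).symm
      rw [inner_smul_left, Submodule.mem_orthogonal _ _ |>.1 hv _
        (Submodule.subset_span ⟨a, rfl⟩), mul_zero])

theorem tensorBasis_apply (a : ∀ i, κ i) : tensorBasis e a = tmul fun i => e i (a i) := by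
  rw [tensorBasis, HilbertBasis.coe_mkOfOrthogonalEqBot]

/-- The tensor product of finite-rank basis projections. -/
def tensorProj (F : ∀ i, Finset (κ i)) : HTensor E →L[ℂ] HTensor E :=
  basisProj (tensorBasis e) (Fintype.piFinset F)

theorem tensorProj_tmul (F : ∀ i, Finset (κ i)) (x : ∀ i, E i) :
    tensorProj e F (tmul x) = tmul fun i => basisProj (e i) (F i) (x i) := by
  rw [tensorProj, basisProj_apply, ← sum_tmul_basis]
  simp_rw [tensorBasis_apply]

theorem inner_tensorProj (F : ∀ i, Finset (κ i)) (u v : HTensor E) :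
    ⟪u, tensorProj e F v⟫_ℂ = ⟪tensorProj e F u, v⟫_ℂ := by
  rw [← ContinuousLinearMap.adjoint_inner_left, ← ContinuousLinearMap.star_eq_adjoint, tensorProj,
    star_basisProj]

/-- Boxes are cofinal among finite sets of multi-indices, so limits over all finite sets may be
taken along product projections. -/
theorem tendsto_piFinset :
    Tendsto (fun F : ∀ i, Finset (κ i) => Fintype.piFinset F) atTop atTop := by
  classical
  rw [tendsto_atTop]
  intro A
  filter_upwards [eventually_ge_atTop fun i => A.image fun a => a i] with F hF
  intro a ha
  exact Fintype.mem_piFinset.2 fun i => hF i (Finset.mem_image_of_mem _ ha)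

end TensorBasis

/-! ### Product vectors with respect to a partition. -/

section BlockProduct

variable {m : ℕ} {H : Fin m → Type*} [∀ i, NormedAddCommGroup (H i)]
  [∀ i, InnerProductSpace ℂ (H i)] [∀ i, CompleteSpace (H i)]

/-- A product projection is self-adjoint and acts party by party, hence block by block for every
partition. This is why local compression creates no entanglement. -/
theorem IsBlockProduct.tensorProj {κ : Fin m → Type*} (e : ∀ i, HilbertBasis (κ i) ℂ (H i))
    (F : ∀ i, Finset (κ i)) {p : Partition m} {Φ : ∀ B : p.parts, BlockSpace H B.1}
    {Ψ : HTensor H} (h : IsBlockProduct p Φ Ψ) :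
    IsBlockProduct p (fun B =>
      PiEntanglement.tensorProj (fun i : B.1 => e i) (fun i : B.1 => F i) (Φ B))
      (PiEntanglement.tensorProj e F Ψ) := by
  intro x
  rw [inner_tensorProj, tensorProj_tmul, h]
  refine Finset.prod_congr rfl fun B _ => ?_
  rw [inner_tensorProj, tensorProj_tmul]

theorem prod_parts (p : Partition m) (f : Fin m → ℂ) :
    ∏ B : p.parts, ∏ i : B.1, f i = ∏ i, f i := by
  rw [Finset.prod_coe_sort p.parts fun B => ∏ i : B, f i]
  simp_rw [Finset.prod_coe_sort _ f]
  conv_rhs => rw [← p.biUnion_parts]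
  rw [Finset.prod_biUnion p.supIndep.pairwiseDisjoint]
  rfl

theorem isBlockProduct_tmul (p : Partition m) (x : ∀ i, H i) :
    IsBlockProduct p (fun B => tmul fun i : B.1 => x i) (tmul x) := by
  intro y
  simp_rw [inner_tmul]
  rw [prod_parts p fun i => ⟪y i, x i⟫_ℂ]

theorem IsBlockProduct.smul {p : Partition m} {Φ : ∀ B : p.parts, BlockSpace H B.1}
    {Ψ : HTensor H} (h : IsBlockProduct p Φ Ψ) (c : p.parts → ℂ) :
    IsBlockProduct p (fun B => c B • Φ B) ((∏ B, c B) • Ψ) := by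
  intro x
  simp_rw [inner_smul_right, Finset.prod_mul_distrib]
  rw [h x]

theorem IsBlockProduct.eq_zero {p : Partition m} {Φ : ∀ B : p.parts, BlockSpace H B.1}
    {Ψ : HTensor H} (h : IsBlockProduct p Φ Ψ) {B : p.parts} (hB : Φ B = 0) : Ψ = 0 := by
  refine ext_inner_tmul fun x => ?_
  rw [h x, inner_zero_right]
  exact Finset.prod_eq_zero (Finset.mem_univ B) (by rw [hB, inner_zero_right])

end BlockProduct

/-! ### Positivity under limits, and cones versus trace-norm closures. -/

section Cone

open Filter

variable {H : Type*} [NormedAddCommGroup H] [InnerProductSpace ℂ H] [CompleteSpace H]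

/-- The approximant may depend on `x`, so the criterion serves both trace-norm limits and weak
limits. -/
theorem isPositive_of_approx {T : H →L[ℂ] H}
    (h : ∀ x, ∀ ε : ℝ, 0 < ε → ∃ S : H →L[ℂ] H, S.IsPositive ∧ ‖⟪x, (T - S) x⟫_ℂ‖ < ε) :
    T.IsPositive := by
  rw [ContinuousLinearMap.isPositive_iff_complex]
  intro x
  have h1 : ∀ ε : ℝ, 0 < ε → -ε ≤ (⟪x, T x⟫_ℂ).re ∧ |(⟪x, T x⟫_ℂ).im| ≤ ε := by
    intro ε hε
    obtain ⟨S, hS, hd⟩ := h x ε hε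
    rw [sub_apply, inner_sub_right, inner_eq_re_of_isPositive hS] at hd
    have hre := (Complex.abs_re_le_norm _).trans hd.le
    have him := (Complex.abs_im_le_norm _).trans hd.le
    rw [Complex.sub_re, Complex.ofReal_re] at hre
    rw [Complex.sub_im, Complex.ofReal_im, sub_zero] at him
    refine ⟨?_, him⟩
    have := hS.re_inner_nonneg_right x
    linarith [(abs_le.1 hre).1]
  have hre : 0 ≤ (⟪x, T x⟫_ℂ).re :=
    le_of_forall_pos_lt_add fun ε hε => by linarith [(h1 (ε / 2) (half_pos hε)).1]
  have him : (⟪x, T x⟫_ℂ).im = 0 := by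
    rw [← abs_nonpos_iff]
    exact le_of_forall_pos_le_add fun ε hε => by linarith [(h1 ε hε).2]
  have hswap : ⟪T x, x⟫_ℂ = starRingEnd ℂ ⟪x, T x⟫_ℂ := (inner_conj_symm _ _).symm
  rw [hswap]
  refine ⟨Complex.ext ?_ ?_, ?_⟩
  · simp
  · rw [Complex.conj_im, him]
    simp
  · rw [RCLike.conj_re]
    exact hre

theorem norm_inner_lt_of_traceNorm_lt {T : H →L[ℂ] H} {x y : H} {ε : ℝ}
    (h : traceNorm T < ENNReal.ofReal (ε / (‖x‖ * ‖y‖ + 1))) : ‖⟪x, T y⟫_ℂ‖ < ε := by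
  have hpos : 0 < ‖x‖ * ‖y‖ + 1 := by positivity
  have hε : 0 < ε := by
    have h0 := (zero_le).trans_lt h
    rw [ENNReal.ofReal_pos] at h0
    exact (div_pos_iff_of_pos_right hpos).1 h0
  have h1 := ofReal_norm_inner_le T x y
  have h2 : ENNReal.ofReal ‖⟪x, T y⟫_ℂ‖ < ENNReal.ofReal ε := by
    refine h1.trans_lt ?_
    calc ENNReal.ofReal (‖x‖ * ‖y‖) * traceNorm T
        ≤ ENNReal.ofReal (‖x‖ * ‖y‖) * ENNReal.ofReal (ε / (‖x‖ * ‖y‖ + 1)) := by gcongr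
      _ = ENNReal.ofReal ((‖x‖ * ‖y‖) * (ε / (‖x‖ * ‖y‖ + 1))) :=
        (ENNReal.ofReal_mul (by positivity)).symm
      _ < ENNReal.ofReal ε := by
        rw [ENNReal.ofReal_lt_ofReal_iff hε, mul_div_left_comm]
        exact mul_lt_of_lt_one_right hε ((div_lt_one hpos).2 (by linarith))
  exact (ENNReal.ofReal_lt_ofReal_iff hε).1 h2

theorem isPositive_of_mem_traceNormClosure {S : Set (H →L[ℂ] H)}
    (hS : ∀ X ∈ S, X.IsPositive) {T : H →L[ℂ] H} (hT : T ∈ traceNormClosure S) :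
    T.IsPositive := by
  refine isPositive_of_approx fun x ε hε => ?_
  obtain ⟨X, hX, hd⟩ := hT.2 (ENNReal.ofReal (ε / (‖x‖ * ‖x‖ + 1)))
    (ENNReal.ofReal_pos.2 (by positivity))
  exact ⟨X, hS X hX, norm_inner_lt_of_traceNorm_lt hd⟩

theorem traceNorm_eq_of_mem_traceNormClosure {S : Set (H →L[ℂ] H)}
    (hS : ∀ X ∈ S, traceNorm X = 1) {T : H →L[ℂ] H} (hT : T ∈ traceNormClosure S) :
    traceNorm T = 1 := by
  refine le_antisymm ?_ ?_
  · refine ENNReal.le_of_forall_pos_le_add fun ε hε _ => ?_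
    obtain ⟨X, hX, hd⟩ := hT.2 ε (by exact_mod_cast hε)
    have := traceNorm_add_le X (T - X)
    rw [add_sub_cancel, hS X hX] at this
    exact this.trans (by gcongr)
  · refine ENNReal.le_of_forall_pos_le_add fun ε hε _ => ?_
    obtain ⟨X, hX, hd⟩ := hT.2 ε (by exact_mod_cast hε)
    have := traceNorm_add_le T (X - T)
    rw [add_sub_cancel, hS X hX, traceNorm_sub_comm] at this
    exact this.trans (by gcongr)

theorem cone_add {D : Set (H →L[ℂ] H)} (hD : Convex ℝ D) {X Y : H →L[ℂ] H} (hX : X ∈ cone D)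
    (hY : Y ∈ cone D) : X + Y ∈ cone D := by
  obtain ⟨c, hc, X, hX, rfl⟩ := hX
  obtain ⟨d, hd, Y, hY, rfl⟩ := hY
  rcases (add_nonneg hc hd).eq_or_lt with h | h
  · have hc0 : c = 0 := by linarith
    have hd0 : d = 0 := by linarith
    exact ⟨0, le_rfl, X, hX, by simp [hc0, hd0]⟩
  · refine ⟨c + d, h.le, (c / (c + d)) • X + (d / (c + d)) • Y,
      hD hX hY (by positivity) (by positivity) (by field_simp), ?_⟩
    rw [smul_add, smul_smul, smul_smul, mul_div_cancel₀ _ h.ne', mul_div_cancel₀ _ h.ne']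

theorem cone_smul {D : Set (H →L[ℂ] H)} {X : H →L[ℂ] H} (hX : X ∈ cone D) {c : ℝ} (hc : 0 ≤ c) :
    c • X ∈ cone D := by
  obtain ⟨d, hd, X, hX, rfl⟩ := hX
  exact ⟨c * d, mul_nonneg hc hd, X, hX, by rw [smul_smul]⟩

/-- On `D` the trace norm is one, so the coefficient of `c • Y` is its trace norm. If `c • Y` is
close to `T`, then `c` is close to `‖T‖₁` and `Y` is close to the normalisation of `T`. -/
theorem cone_traceNormClosure {D : Set (H →L[ℂ] H)} (hne : D.Nonempty)
    (hD : ∀ X ∈ D, traceNorm X = 1) : cone (traceNormClosure D) = traceNormClosure (cone D) := by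
  ext T
  constructor
  · rintro ⟨c, hc, X, hX, rfl⟩
    refine ⟨?_, fun ε hε => ?_⟩
    · rw [IsTraceClass, traceNorm_real_smul hc]
      exact ENNReal.mul_lt_top ENNReal.ofReal_lt_top hX.1
    · obtain ⟨n, hn, hlt⟩ := ENNReal.exists_nnreal_pos_mul_lt
        (ENNReal.ofReal_ne_top (r := c)) hε.ne'
      obtain ⟨Y, hY, hd⟩ := hX.2 n (by exact_mod_cast hn)
      refine ⟨c • Y, ⟨c, hc, Y, hY, rfl⟩, ?_⟩
      rw [← smul_sub, traceNorm_real_smul hc]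
      refine lt_of_le_of_lt ?_ hlt
      rw [mul_comm]
      gcongr
  · rintro ⟨hT, h⟩
    obtain ⟨Z, hZ⟩ := hne
    have htop : traceNorm T ≠ ∞ := hT.ne
    set t := (traceNorm T).toReal with ht
    have htT : ENNReal.ofReal t = traceNorm T := ENNReal.ofReal_toReal htop
    -- The zero operator cannot be normalised; it is written as `0 • Z`, which is where `D` must be
    -- non-empty.
    rcases (ENNReal.toReal_nonneg (a := traceNorm T)).eq_or_lt with h0 | h0
    · have hT0 : T = 0 := eq_zero_of_traceNorm_eq_zero
        (htT.symm.trans (by rw [show t = 0 from h0.symm, ENNReal.ofReal_zero]))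
      refine ⟨0, le_rfl, Z, ⟨?_, fun ε hε => ⟨Z, hZ, by simpa using hε⟩⟩, by simp [hT0]⟩
      rw [IsTraceClass, hD Z hZ]
      exact ENNReal.one_lt_top
    · change 0 < t at h0
      refine ⟨t, h0.le, t⁻¹ • T, ⟨?_, fun ε hε => ?_⟩, by
        rw [smul_smul, mul_inv_cancel₀ h0.ne', one_smul]⟩
      · rw [IsTraceClass, traceNorm_real_smul (inv_nonneg.2 h0.le)]
        exact ENNReal.mul_lt_top ENNReal.ofReal_lt_top hT
      -- The factor `2` covers two errors of size `n`: from `T` to `c • Y`, and from `c • Y` to `t •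
      -- Y`.
      · obtain ⟨n, hn, hlt⟩ := ENNReal.exists_nnreal_pos_mul_lt
          (ENNReal.mul_ne_top (ENNReal.ofReal_ne_top (r := t⁻¹)) (ENNReal.ofNat_ne_top (n := 2)))
          hε.ne'
        obtain ⟨_, ⟨c, hc, Y, hY, rfl⟩, hd⟩ := h n (by exact_mod_cast hn)
        refine ⟨Y, hY, ?_⟩
        have h1 : t⁻¹ • T - Y = t⁻¹ • (T - t • Y) := by
          rw [smul_sub, smul_smul, inv_mul_cancel₀ h0.ne', one_smul]
        rw [h1, traceNorm_real_smul (inv_nonneg.2 h0.le)]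
        have h2 : traceNorm (c • Y - t • Y) ≤ n := by
          have hYn := hD Y hY
          have ha : traceNorm (c • Y) = ENNReal.ofReal c := by
            rw [traceNorm_real_smul hc, hYn, mul_one]
          have hb1 := traceNorm_add_le (c • Y) (T - c • Y)
          have hb2 := traceNorm_add_le T (c • Y - T)
          rw [add_sub_cancel, ha, ← htT] at hb1
          rw [add_sub_cancel, ha, ← htT, traceNorm_sub_comm] at hb2
          have hn' : (n : ℝ≥0∞) = ENNReal.ofReal n := (ENNReal.ofReal_coe_nnreal).symm
          have hc1 : t ≤ c + n := by
            rw [← ENNReal.ofReal_le_ofReal_iff (by positivity), ENNReal.ofReal_add hc n.coe_nonneg,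
              ← hn']
            exact hb1.trans (by gcongr)
          have hc2 : c ≤ t + n := by
            rw [← ENNReal.ofReal_le_ofReal_iff (by positivity), ENNReal.ofReal_add h0.le n.coe_nonneg,
              ← hn']
            exact hb2.trans (by gcongr)
          rw [← sub_smul]
          have hsm := traceNorm_smul ((c - t : ℝ) : ℂ) Y
          rw [Complex.coe_smul, hYn, mul_one, Complex.norm_real] at hsm
          rw [hsm, hn']
          refine ENNReal.ofReal_le_ofReal ?_
          rw [Real.norm_eq_abs, abs_le]
          constructor <;> linarith
        have h3 := (traceNorm_sub_le T (c • Y) (t • Y)).trans (add_le_add hd.le h2)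
        refine lt_of_le_of_lt ?_ hlt
        calc ENNReal.ofReal t⁻¹ * traceNorm (T - t • Y)
            ≤ ENNReal.ofReal t⁻¹ * (n + n) := by gcongr
          _ = n * (ENNReal.ofReal t⁻¹ * 2) := by ring

end Cone

/-! ### Weak*-closedness of the cone of separable states. -/

section SeparableCone

open Filter

variable {m : ℕ} {H : Fin m → Type*} [∀ i, NormedAddCommGroup (H i)]
  [∀ i, InnerProductSpace ℂ (H i)] [∀ i, CompleteSpace (H i)]

theorem norm_basisProj_sq {K κ : Type*} [NormedAddCommGroup K] [InnerProductSpace ℂ K]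
    [CompleteSpace K] (e : HilbertBasis κ ℂ K) (A : Finset κ) (x : K) :
    ‖basisProj e A x‖ ^ 2 = ∑ a ∈ A, ‖⟪e a, x⟫_ℂ‖ ^ 2 := by
  have h := e.orthonormal.inner_sum (fun a => ⟪e a, x⟫_ℂ) (fun a => ⟪e a, x⟫_ℂ) A
  rw [← basisProj_apply, inner_self_eq_norm_sq_to_K] at h
  simp_rw [RCLike.conj_mul] at h
  exact_mod_cast h

/-- A multi-index on `[m]` is the same as a family of multi-indices on the blocks of `p`. -/
theorem sum_prod_parts {κ : Fin m → Type*} (p : Partition m) (F : ∀ i, Finset (κ i))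
    (g : ∀ B : p.parts, (∀ i : B.1, κ i) → ℝ) :
    ∑ a ∈ Fintype.piFinset F, ∏ B : p.parts, g B (fun i => a i) =
      ∏ B : p.parts, ∑ b ∈ Fintype.piFinset fun i : B.1 => F i, g B b := by
  rw [Finset.prod_univ_sum]
  have hpart : ∀ i, p.part i ∈ p.parts := fun i => p.part_mem.2 (Finset.mem_univ i)
  have hmem : ∀ i, i ∈ p.part i := fun i => p.mem_part (Finset.mem_univ i)
  refine Finset.sum_bij (fun a _ => fun (B : p.parts) (i : B.1) => a i) ?_ ?_ ?_ ?_
  · intro a ha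
    rw [Fintype.mem_piFinset]
    intro B
    rw [Fintype.mem_piFinset]
    exact fun i => Fintype.mem_piFinset.1 ha i
  · intro a _ b _ h
    funext i
    exact congrFun (congrFun h ⟨p.part i, hpart i⟩) ⟨i, hmem i⟩
  · intro x hx
    refine ⟨fun i => x ⟨p.part i, hpart i⟩ ⟨i, hmem i⟩, ?_, ?_⟩
    · rw [Fintype.mem_piFinset]
      intro i
      exact Fintype.mem_piFinset.1 (Fintype.mem_piFinset.1 hx ⟨p.part i, hpart i⟩) ⟨i, hmem i⟩
    · funext B i
      have key : ∀ (C : Finset (Fin m)) (hC : C ∈ p.parts) (hi : i.1 ∈ C), C = B.1 →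
          x ⟨C, hC⟩ ⟨i.1, hi⟩ = x B i := by
        rintro C hC hi rfl
        rfl
      exact key _ _ _ (p.part_eq_of_mem B.2 i.2)
  · intro a _
    rfl

/-- Block products are known only through inner products with elementary tensors. Parseval on a box
factorises over the blocks, and the box then exhausts the basis. This gives pure product states
trace norm one. -/
theorem IsBlockProduct.norm_eq {p : Partition m} {Φ : ∀ B : p.parts, BlockSpace H B.1}
    {Ψ : HTensor H} (h : IsBlockProduct p Φ Ψ) : ‖Ψ‖ = ∏ B, ‖Φ B‖ := by
  classical
  let e : ∀ i, HilbertBasis (basisIndex (H i)) ℂ (H i) := fun i => someBasis (H i)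
  have hfin : ∀ F : ∀ i, Finset (basisIndex (H i)), ‖PiEntanglement.tensorProj e F Ψ‖ ^ 2 =
      ∏ B : p.parts,
        ‖PiEntanglement.tensorProj (fun i : B.1 => e i) (fun i : B.1 => F i) (Φ B)‖ ^ 2 := by
    intro F
    simp_rw [PiEntanglement.tensorProj, norm_basisProj_sq, tensorBasis_apply]
    rw [← sum_prod_parts p F fun B b => ‖⟪tmul fun i : B.1 => e i (b i), Φ B⟫_ℂ‖ ^ 2]
    refine Finset.sum_congr rfl fun a _ => ?_
    rw [h, norm_prod, Finset.prod_pow]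
  have h1 : Tendsto (fun F : ∀ i, Finset (basisIndex (H i)) =>
      ‖PiEntanglement.tensorProj e F Ψ‖ ^ 2) atTop (𝓝 (‖Ψ‖ ^ 2)) :=
    (((tendsto_basisProj (tensorBasis e) Ψ).comp tendsto_piFinset).norm).pow 2
  have h2 : Tendsto (fun F : ∀ i, Finset (basisIndex (H i)) => ∏ B : p.parts,
      ‖PiEntanglement.tensorProj (fun i : B.1 => e i) (fun i : B.1 => F i) (Φ B)‖ ^ 2) atTop
      (𝓝 (∏ B, ‖Φ B‖ ^ 2)) := by
    refine tendsto_finsetProd _ fun B _ => ?_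
    refine (((tendsto_basisProj (tensorBasis fun i : B.1 => e i) (Φ B)).comp
      (tendsto_piFinset.comp ?_)).norm).pow 2
    refine tendsto_atTop_atTop_of_monotone (fun F G hFG i => hFG i) fun b => ?_
    refine ⟨fun i => if hi : i ∈ B.1 then b ⟨i, hi⟩ else ∅, fun i => ?_⟩
    simp
  have h3 := tendsto_nhds_unique h1 (h2.congr fun F => (hfin F).symm)
  rw [Finset.prod_pow] at h3
  exact (pow_left_inj₀ (norm_nonneg _) (Finset.prod_nonneg fun _ _ => norm_nonneg _)
    two_ne_zero).1 h3

variable {P : Set (Partition m)}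

theorem isPositive_traceNorm_of_mem_convexHull {X : HTensor H →L[ℂ] HTensor H}
    (hX : X ∈ convexHull ℝ (pureProductStates H P)) : X.IsPositive ∧ traceNorm X = 1 := by
  refine convexHull_min (t := {X | X.IsPositive ∧ traceNorm X = 1}) ?_ ?_ hX
  · rintro _ ⟨p, hp, Φ, Ψ, hΦ, hΨ, rfl⟩
    refine ⟨InnerProductSpace.isPositive_rankOne_self Ψ, ?_⟩
    rw [traceNorm_rankOne_self, hΨ.norm_eq]
    simp [hΦ]
  · rintro X ⟨hX, hX'⟩ Y ⟨hY, hY'⟩ a b ha hb hab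
    have h1 := isPositive_real_smul hX ha
    have h2 := isPositive_real_smul hY hb
    refine ⟨h1.add h2, ?_⟩
    rw [traceNorm_add_of_isPositive h1 h2, traceNorm_real_smul ha, traceNorm_real_smul hb, hX', hY',
      mul_one, mul_one, ← ENNReal.ofReal_add ha hb, hab, ENNReal.ofReal_one]

theorem isState_of_mem_separableStates {X : HTensor H →L[ℂ] HTensor H}
    (hX : X ∈ separableStates H P) : IsState X :=
  isState_iff.2 ⟨isPositive_of_mem_traceNormClosure
    (fun _ h => (isPositive_traceNorm_of_mem_convexHull h).1) hX,
    traceNorm_eq_of_mem_traceNormClosure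
    (fun _ h => (isPositive_traceNorm_of_mem_convexHull h).2) hX⟩

/-- Compression destroys the normalisation of the block vectors. Non-zero ones are rescaled, the
scalar being absorbed by the cone; a zero one makes the whole projector zero. -/
theorem IsBlockProduct.rankOne_mem_cone (hne : (pureProductStates H P).Nonempty) {p : Partition m}
    (hp : p ∈ P) {Φ : ∀ B : p.parts, BlockSpace H B.1} {Ψ : HTensor H} (h : IsBlockProduct p Φ Ψ) :
    InnerProductSpace.rankOne ℂ Ψ Ψ ∈ cone (convexHull ℝ (pureProductStates H P)) := by
  by_cases h0 : ∃ B, Φ B = 0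
  · obtain ⟨B, hB⟩ := h0
    obtain ⟨X, hX⟩ := hne
    exact ⟨0, le_rfl, X, subset_convexHull ℝ _ hX, by simp [h.eq_zero hB]⟩
  · push Not at h0
    have hn : ∀ B, (‖Φ B‖ : ℂ) ≠ 0 := fun B => by
      exact_mod_cast norm_ne_zero_iff.2 (h0 B)
    set c : ℂ := ∏ B, (‖Φ B‖ : ℂ)⁻¹ with hc
    have hc0 : c ≠ 0 := Finset.prod_ne_zero_iff.2 fun B _ => inv_ne_zero (hn B)
    refine ⟨(‖c‖⁻¹) ^ 2, by positivity, InnerProductSpace.rankOne ℂ (c • Ψ) (c • Ψ),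
      subset_convexHull ℝ _ ⟨p, hp, _, _, fun B => ?_, h.smul fun B => (‖Φ B‖ : ℂ)⁻¹, rfl⟩, ?_⟩
    · rw [norm_smul, norm_inv, Complex.norm_real, norm_norm,
        inv_mul_cancel₀ (norm_ne_zero_iff.2 (h0 B))]
    · ext v
      simp only [smul_apply, InnerProductSpace.rankOne_apply, inner_smul_left]
      rw [smul_smul, ← Complex.coe_smul, smul_smul]
      congr 1
      have h2 : starRingEnd ℂ c * c = ((‖c‖ ^ 2 : ℝ) : ℂ) := by
        rw [RCLike.conj_mul]
        norm_cast
      have h3 : ((‖c‖ : ℝ) : ℂ) ≠ 0 := by exact_mod_cast norm_ne_zero_iff.2 hc0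
      calc ⟪Ψ, v⟫_ℂ = ((((‖c‖⁻¹) ^ 2 : ℝ) : ℂ) * ((‖c‖ ^ 2 : ℝ) : ℂ)) * ⟪Ψ, v⟫_ℂ := by
            push_cast
            field_simp
        _ = _ := by
            rw [← h2]
            ring

theorem compression_mem_cone (hne : (pureProductStates H P).Nonempty) {κ : Fin m → Type*}
    (e : ∀ i, HilbertBasis (κ i) ℂ (H i)) (F : ∀ i, Finset (κ i)) {X : HTensor H →L[ℂ] HTensor H}
    (hX : X ∈ cone (convexHull ℝ (pureProductStates H P))) :
    tensorProj e F * X * tensorProj e F ∈ cone (convexHull ℝ (pureProductStates H P)) := by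
  set Q := tensorProj e F with hQ
  obtain ⟨c, hc, X, hX, rfl⟩ := hX
  rw [mul_smul_comm, smul_mul_assoc]
  refine cone_smul ?_ hc
  refine convexHull_min
    (t := {X | Q * X * Q ∈ cone (convexHull ℝ (pureProductStates H P))}) ?_ ?_ hX
  · rintro _ ⟨p, hp, Φ, Ψ, hΦ, hΨ, rfl⟩
    have h1 := (hΨ.tensorProj e F).rankOne_mem_cone hne hp
    have h2 : Q * InnerProductSpace.rankOne ℂ Ψ Ψ * Q =
        InnerProductSpace.rankOne ℂ (tensorProj e F Ψ) (tensorProj e F Ψ) := by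
      ext v
      simp only [mul_apply_eq_comp, InnerProductSpace.rankOne_apply, map_smul, hQ, inner_tensorProj]
    rwa [Set.mem_ofPred_eq, h2]
  · intro X hX Y hY a b ha hb hab
    rw [Set.mem_ofPred_eq] at hX hY ⊢
    rw [mul_add, add_mul, mul_smul_comm, mul_smul_comm, smul_mul_assoc, smul_mul_assoc]
    exact cone_add (convex_convexHull ℝ _) (cone_smul hX ha) (cone_smul hY hb)

/-- On a finite-dimensional corner, uniform smallness of matrix elements is smallness in trace norm:
the corner is a sum of `|A|²` rank-one terms. -/
theorem traceNorm_compression_le {K κ : Type*} [NormedAddCommGroup K] [InnerProductSpace ℂ K]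
    [CompleteSpace K] (e : HilbertBasis κ ℂ K) (A : Finset κ) (T : K →L[ℂ] K) {δ : ℝ}
    (h : ∀ a ∈ A, ∀ b ∈ A, ‖⟪e a, T (e b)⟫_ℂ‖ ≤ δ) :
    traceNorm (basisProj e A * T * basisProj e A) ≤ A.card * (A.card * ENNReal.ofReal δ) := by
  have h1 : basisProj e A * T * basisProj e A =
      ∑ a ∈ A, ∑ b ∈ A, ⟪e a, T (e b)⟫_ℂ • InnerProductSpace.rankOne ℂ (e a) (e b) := by
    ext v
    simp only [mul_apply_eq_comp, basisProj_apply, sum_apply]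
    refine Finset.sum_congr rfl fun a _ => ?_
    simp only [map_sum, inner_sum, Finset.sum_smul]
    refine Finset.sum_congr rfl fun b _ => ?_
    simp only [map_smul, inner_smul_right, smul_apply, InnerProductSpace.rankOne_apply, smul_smul]
    rw [mul_comm]
  rw [h1]
  refine (traceNorm_sum_le _ _).trans ?_
  rw [← nsmul_eq_mul]
  refine Finset.sum_le_card_nsmul _ _ _ fun a ha => (traceNorm_sum_le _ _).trans ?_
  rw [← nsmul_eq_mul]
  refine Finset.sum_le_card_nsmul _ _ _ fun b hb => ?_
  rw [traceNorm_smul]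
  refine (mul_le_of_le_one_right zero_le
    (traceNorm_rankOne_le (e.orthonormal.1 a).le (e.orthonormal.1 b).le)).trans ?_
  exact ENNReal.ofReal_le_ofReal (h a ha b hb)

theorem cone_separableStates (hne : (pureProductStates H P).Nonempty) :
    cone (separableStates H P) =
      traceNormClosure (cone (convexHull ℝ (pureProductStates H P))) :=
  cone_traceNormClosure (hne.mono (subset_convexHull ℝ _))
    fun _ h => (isPositive_traceNorm_of_mem_convexHull h).2

/-- A positive trace-class operator lies in the cone of separable states if finitely many of its
matrix elements can be approximated at a time. -/
theorem mem_cone_of_approx (hne : (pureProductStates H P).Nonempty)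
    {T : HTensor H →L[ℂ] HTensor H} (hT : T.IsPositive) (hT' : IsTraceClass T)
    (h : ∀ (A : Finset (HTensor H)) (ε : ℝ), 0 < ε → ∃ S ∈ cone (separableStates H P),
      ∀ x ∈ A, ∀ y ∈ A, ‖⟪x, (T - S) y⟫_ℂ‖ < ε) : T ∈ cone (separableStates H P) := by
  classical
  rw [cone_separableStates hne] at h ⊢
  refine ⟨hT', fun ε hε => ?_⟩
  have hε3 : 0 < ε / 3 := ENNReal.div_pos hε.ne' (by norm_num)
  let e : ∀ i, HilbertBasis (basisIndex (H i)) ℂ (H i) := fun i => someBasis (H i)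
  set b := tensorBasis e with hb
  have hlim := (tendsto_traceNorm_sub_compression b hT hT').comp tendsto_piFinset
  obtain ⟨F, hF⟩ := ((tendsto_order.1 hlim).2 _ hε3).exists
  set A := Fintype.piFinset F with hA
  set Q := tensorProj e F with hQ
  have hQA : Q = basisProj b A := rfl
  -- The accuracy `δ` is chosen after the corner `A` is fixed, so that `|A|² δ < ε / 3`. The
  -- approximation then runs `T ≈ QTQ ≈ QSQ ≈ QXQ`.
  obtain ⟨δ, hδ, hδ'⟩ := ENNReal.exists_nnreal_pos_mul_lt (a := (A.card * A.card : ℝ≥0∞))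
    (ENNReal.mul_ne_top (ENNReal.natCast_ne_top _) (ENNReal.natCast_ne_top _)) hε3.ne'
  obtain ⟨S, hS, hd⟩ := h (A.image b) δ (by exact_mod_cast hδ)
  obtain ⟨X, hX, hdX⟩ := hS.2 _ hε3
  refine ⟨Q * X * Q, compression_mem_cone hne e F hX, ?_⟩
  have hQn : ‖Q‖ ≤ 1 := norm_basisProj_le b A
  have h1 : traceNorm (T - Q * T * Q) < ε / 3 := hF
  have h2 : traceNorm (Q * T * Q - Q * S * Q) < ε / 3 := by
    rw [← sub_mul, ← mul_sub, hQA]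
    refine (traceNorm_compression_le b A (T - S) (δ := δ) fun a ha a' ha' =>
      (hd _ (Finset.mem_image_of_mem _ ha) _ (Finset.mem_image_of_mem _ ha')).le).trans_lt ?_
    rwa [← mul_assoc, mul_comm, ENNReal.ofReal_coe_nnreal]
  have h3 : traceNorm (Q * S * Q - Q * X * Q) < ε / 3 := by
    rw [← sub_mul, ← mul_sub]
    exact (traceNorm_mul_mul_le _ hQn hQn).trans_lt hdX
  calc traceNorm (T - Q * X * Q)
      ≤ traceNorm (T - Q * T * Q) + (traceNorm (Q * T * Q - Q * S * Q) +
          traceNorm (Q * S * Q - Q * X * Q)) :=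
        (traceNorm_sub_le _ (Q * T * Q) _).trans (by gcongr; exact traceNorm_sub_le _ _ _)
    _ < ε / 3 + (ε / 3 + ε / 3) := ENNReal.add_lt_add h1 (ENNReal.add_lt_add h2 h3)
    _ = ε := by rw [← add_assoc, ENNReal.add_thirds]

theorem isPositive_of_mem_cone {X : HTensor H →L[ℂ] HTensor H}
    (hX : X ∈ cone (separableStates H P)) : X.IsPositive := by
  obtain ⟨c, hc, X, hX, rfl⟩ := hX
  exact isPositive_real_smul (isState_of_mem_separableStates hX).1 hc

theorem isTraceClass_of_mem_cone {X : HTensor H →L[ℂ] HTensor H}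
    (hX : X ∈ cone (separableStates H P)) : IsTraceClass X := by
  obtain ⟨c, hc, X, hX, rfl⟩ := hX
  rw [IsTraceClass, traceNorm_real_smul hc]
  exact ENNReal.mul_lt_top ENNReal.ofReal_lt_top (isState_of_mem_separableStates hX).2.1

theorem isWeakStarClosed_cone : IsWeakStarClosed (cone (separableStates H P)) := by
  classical
  refine ⟨fun T hT => isTraceClass_of_mem_cone hT, ?_⟩
  -- With no pure product states the cone is empty, so it does not even contain zero, but it is
  -- closed.
  rcases (pureProductStates H P).eq_empty_or_nonempty with h0 | hne
  · have h1 : cone (separableStates H P) = ∅ := by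
      rw [Set.eq_empty_iff_forall_notMem]
      rintro _ ⟨c, hc, X, ⟨-, hX⟩, rfl⟩
      obtain ⟨Y, hY, -⟩ := hX 1 one_pos
      rw [h0, convexHull_empty] at hY
      exact hY
    simp only [h1, Set.mem_empty_iff_false, Set.ofPred_false]
    exact @isClosed_empty _ (weakStar _)
  let _ : TopologicalSpace (TraceClass (HTensor H)) := weakStar (HTensor H)
  have hcont : ∀ x y : HTensor H, Continuous fun T : TraceClass (HTensor H) => ⟪x, T.1 y⟫_ℂ := by
    intro x y
    have h1 : Continuous fun T : TraceClass (HTensor H) =>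
        trace (T.1 * InnerProductSpace.rankOne ℂ y x) :=
      continuous_iInf_dom (i := ⟨InnerProductSpace.rankOne ℂ y x, isCompactOperator_rankOne y x⟩)
        continuous_induced_dom
    simpa only [trace_mul_rankOne] using h1
  refine isClosed_of_closure_subset fun T hT => ?_
  have happ : ∀ (A : Finset (HTensor H)) (ε : ℝ), 0 < ε → ∃ S ∈ cone (separableStates H P),
      ∀ x ∈ A, ∀ y ∈ A, ‖⟪x, (T.1 - S) y⟫_ℂ‖ < ε := by
    intro A ε hε
    let U : Set (TraceClass (HTensor H)) :=
      ⋂ x ∈ A, ⋂ y ∈ A, {S | ‖⟪x, T.1 y⟫_ℂ - ⟪x, S.1 y⟫_ℂ‖ < ε}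
    have hU : IsOpen U := isOpen_biInter_finset fun x _ => isOpen_biInter_finset fun y _ =>
      isOpen_lt ((continuous_const.sub (hcont x y)).norm) continuous_const
    have hTU : T ∈ U := by
      simp only [U, Set.mem_iInter, Set.mem_ofPred_eq]
      intro x _ y _
      simpa using hε
    obtain ⟨S, hSU, hS⟩ := mem_closure_iff.1 hT U hU hTU
    refine ⟨S.1, hS, fun x hx y hy => ?_⟩
    simp only [U, Set.mem_iInter, Set.mem_ofPred_eq] at hSU
    rw [sub_apply, inner_sub_right]
    exact hSU x hx y hy
  have hpos : T.1.IsPositive := isPositive_of_approx fun x ε hε => by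
    obtain ⟨S, hS, hd⟩ := happ {x} ε hε
    exact ⟨S, isPositive_of_mem_cone hS, hd x (by simp) x (by simp)⟩
  exact mem_cone_of_approx hne hpos T.2 happ

end SeparableCone

/-! ### Integral representation of the entropy terms. -/

section EntropyIntegral

open Filter MeasureTheory Set

/-- `(y - x)² / (y + s x)`, the integrand in the integral representation of `entropyTerm`. -/
def chiTerm (s x y : ℝ) : ℝ≥0∞ := ENNReal.ofReal ((y - x) ^ 2 / (y + s * x))

/-- The weight in the integral representation of `entropyTerm`. -/
def chiWeight (s : ℝ) : ℝ≥0∞ := ENNReal.ofReal (((1 + s) ^ 2)⁻¹)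

theorem chiTerm_mul_chiWeight (s x y : ℝ) : chiTerm s x y * chiWeight s =
    ENNReal.ofReal ((y - x) ^ 2 / (y + s * x) * ((1 + s) ^ 2)⁻¹) :=
  (ENNReal.ofReal_mul' (by positivity)).symm

theorem measurable_chiTerm (x y : ℝ) : Measurable fun s => chiTerm s x y := by
  unfold chiTerm
  fun_prop

theorem measurable_chiWeight : Measurable chiWeight := by
  unfold chiWeight
  fun_prop

theorem lintegral_chiTerm_of_pos {x y : ℝ} (hx : 0 ≤ x) (hy : 0 < y) :
    ∫⁻ s in Ioi (0 : ℝ), chiTerm s x y * chiWeight s =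
      ENNReal.ofReal (x * Real.log x - x * Real.log y + y - x) := by
  simp_rw [chiTerm_mul_chiWeight]
  -- An explicit antiderivative: it equals `-(y - x) + x ln y` at `0` and tends to `x ln x` at
  -- infinity.
  set F : ℝ → ℝ := fun s => -(y - x) / (1 + s) + x * Real.log ((y + s * x) / (1 + s)) with hF
  have hderiv : ∀ s ∈ Ici (0 : ℝ),
      HasDerivAt F ((y - x) ^ 2 / (y + s * x) * ((1 + s) ^ 2)⁻¹) s := by
    intro s hs
    have hs : 0 ≤ s := hs
    have h1 : 0 < 1 + s := by linarith
    have h2 : 0 < y + s * x := by positivity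
    have d1 : HasDerivAt (fun s : ℝ => 1 + s) 1 s := (hasDerivAt_id s).const_add 1
    have d2 : HasDerivAt (fun s : ℝ => y + s * x) (1 * x) s :=
      ((hasDerivAt_id s).mul_const x).const_add y
    have d3 := ((d2.div d1 h1.ne').log (div_pos h2 h1).ne').const_mul x
    have d4 := (d1.fun_inv h1.ne').const_mul (-(y - x))
    refine (d4.add d3).congr_deriv ?_ |>.congr_of_eventuallyEq ?_
    · simp only [Pi.div_apply]
      field_simp
      ring
    · exact Eventually.of_forall fun t => by simp [hF, div_eq_mul_inv]
  have hlim : Tendsto F atTop (𝓝 (x * Real.log x)) := by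
    have h1 : Tendsto (fun s : ℝ => (1 + s)⁻¹) atTop (𝓝 0) :=
      tendsto_inv_atTop_zero.comp (tendsto_atTop_add_const_left _ _ tendsto_id)
    have h2 : Tendsto (fun s : ℝ => -(y - x) * (1 + s)⁻¹ + x * Real.log (x + (y - x) * (1 + s)⁻¹))
        atTop (𝓝 (-(y - x) * 0 + x * Real.log x)) := by
      refine (h1.const_mul _).add ?_
      rcases hx.eq_or_lt with rfl | hx
      · simp
      · have h3 := (h1.const_mul (y - x)).const_add x
        rw [mul_zero, add_zero] at h3
        exact ((Real.continuousAt_log hx.ne').tendsto.comp h3).const_mul x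
    rw [mul_zero, zero_add] at h2
    refine h2.congr' ?_
    filter_upwards [eventually_ge_atTop 0] with s hs
    have h1 : 0 < 1 + s := by linarith
    rw [hF]
    simp only
    congr 3
    field_simp
    ring
  have hnn : ∀ s ∈ Ioi (0 : ℝ), 0 ≤ (y - x) ^ 2 / (y + s * x) * ((1 + s) ^ 2)⁻¹ := by
    intro s hs
    have hs : 0 < s := hs
    positivity
  rw [← ofReal_integral_eq_lintegral_ofReal (integrableOn_Ioi_deriv_of_nonneg' hderiv hnn hlim)
    ((ae_restrict_iff' measurableSet_Ioi).2 (Eventually.of_forall hnn)),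
    integral_Ioi_of_hasDerivAt_of_nonneg' hderiv hnn hlim]
  congr 1
  simp [hF]
  ring

/-- The integrand becomes `x / (s (1 + s)²)`, at least `x / (4 s)` on `(0, 1]`. The divergence at
`0` reproduces the convention `-x ln 0 = ∞`. -/
theorem lintegral_chiTerm_zero_right {x : ℝ} (hx : 0 < x) :
    ∫⁻ s in Ioi (0 : ℝ), chiTerm s x 0 * chiWeight s = ∞ := by
  simp_rw [chiTerm_mul_chiWeight]
  by_contra hne
  have hsub : ∫⁻ s in Ioc (0 : ℝ) 1, ENNReal.ofReal (x / 4 * s⁻¹) ≠ ∞ := by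
    refine ne_top_of_le_ne_top hne ?_
    refine (setLIntegral_mono' measurableSet_Ioc fun s hs => ?_).trans
      (lintegral_mono_set Ioc_subset_Ioi_self)
    refine ENNReal.ofReal_le_ofReal ?_
    obtain ⟨h0, h1⟩ := hs
    have h2 : (0 - x) ^ 2 / (0 + s * x) * ((1 + s) ^ 2)⁻¹ = x * s⁻¹ * ((1 + s) ^ 2)⁻¹ := by
      field_simp
      ring
    rw [h2]
    have h3 : (4 : ℝ)⁻¹ ≤ ((1 + s) ^ 2)⁻¹ := inv_anti₀ (by positivity) (by nlinarith)
    have h4 : 0 < x * s⁻¹ := by positivity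
    nlinarith
  rw [lintegral_ofReal_ne_top_iff_integrable] at hsub
  · have h1 : IntegrableOn (fun s : ℝ => s⁻¹) (Ioc 0 1) := by
      have := hsub.const_mul (4 / x)
      refine this.congr (Eventually.of_forall fun s => ?_)
      field_simp
    rw [← intervalIntegrable_iff_integrableOn_Ioc_of_le zero_le_one,
      intervalIntegrable_inv_iff] at h1
    rcases h1 with h1 | h1
    · exact zero_ne_one h1
    · exact h1 left_mem_uIcc
  · exact (measurable_inv.const_mul (x / 4)).aestronglyMeasurable
  · refine (ae_restrict_iff' measurableSet_Ioc).2 (Eventually.of_forall fun s hs => ?_)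
    have := hs.1
    simp only [Pi.zero_apply]
    positivity

/-- Integral representation of the terms of the relative entropy. -/
theorem lintegral_chiTerm {x y : ℝ} (hx : 0 ≤ x) (hy : 0 ≤ y) :
    ∫⁻ s in Ioi (0 : ℝ), chiTerm s x y * chiWeight s = entropyTerm x y := by
  rcases hy.eq_or_lt with rfl | hy
  · rcases hx.eq_or_lt with rfl | hx
    -- For `x = y = 0` the integrand is `0 / 0 = 0`, in agreement with the convention for the
    -- entropy term.
    · simp [entropyTerm, chiTerm]
    · rw [lintegral_chiTerm_zero_right hx, entropyTerm, if_neg hx.ne', if_pos rfl]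
  · rw [lintegral_chiTerm_of_pos hx hy, entropyTerm]
    split_ifs with h1 h2
    · simp [h1]
    · exact absurd h2 hy.ne'
    · rfl

end EntropyIntegral

/-! ### The double series at a fixed parameter `s`, and its integral. -/

section ChiSeries

open Filter MeasureTheory

variable {H : Type*} [NormedAddCommGroup H] [InnerProductSpace ℂ H] [CompleteSpace H]

/-- Distinct basis vectors are at distance `√2`, so no point of a dense sequence is within `1/2` of
two of them. -/
theorem _root_.HilbertBasis.countable [TopologicalSpace.SeparableSpace H] {ι : Type*}
    (e : HilbertBasis ι ℂ H) : Countable ι := by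
  have h : ∀ i, ∃ n, ‖e i - TopologicalSpace.denseSeq H n‖ < 1 / 2 := fun i => by
    obtain ⟨_, ⟨n, rfl⟩, hn⟩ := Metric.mem_closure_iff.1
      (TopologicalSpace.denseRange_denseSeq H (e i)) (1 / 2) (by norm_num)
    exact ⟨n, by rwa [dist_eq_norm] at hn⟩
  choose n hn using h
  refine Function.Injective.countable (f := n) fun i j hij => ?_
  by_contra hne
  have h1 : ‖e i - e j‖ ^ 2 = 2 := by
    rw [@norm_sub_sq ℂ, e.orthonormal.2 hne, e.orthonormal.1 i, e.orthonormal.1 j]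
    norm_num
  have h2 := hn i
  have h3 := hn j
  rw [← hij, norm_sub_rev] at h3
  have h4 := norm_sub_le_norm_sub_add_norm_sub (e i) (TopologicalSpace.denseSeq H (n i)) (e j)
  nlinarith [norm_nonneg (e i - e j)]

/-- The series `∑ᵢⱼ |⟨eᵢ, fⱼ⟩|² (yⱼ - xᵢ)² / (yⱼ + s xᵢ)`. -/
def chiSeries {ι κ : Type*} (e : HilbertBasis ι ℂ H) (f : HilbertBasis κ ℂ H)
    (x : ι → ℝ) (y : κ → ℝ) (s : ℝ) : ℝ≥0∞ :=
  ∑' (j : κ) (i : ι), ENNReal.ofReal (‖⟪e i, f j⟫_ℂ‖ ^ 2) * chiTerm s (x i) (y j)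

theorem measurable_chiSeries [TopologicalSpace.SeparableSpace H] {ι κ : Type*}
    (e : HilbertBasis ι ℂ H) (f : HilbertBasis κ ℂ H) (x : ι → ℝ) (y : κ → ℝ) :
    Measurable fun s => chiSeries e f x y s := by
  have := e.countable
  have := f.countable
  exact Measurable.tsum fun j => Measurable.tsum fun i =>
    (measurable_chiTerm _ _).const_mul _

/-- Tonelli; separability of `H` makes the sums countable. -/
theorem lintegral_chiSeries [TopologicalSpace.SeparableSpace H] {ι κ : Type*}
    (e : HilbertBasis ι ℂ H) (f : HilbertBasis κ ℂ H) {x : ι → ℝ} {y : κ → ℝ}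
    (hx : ∀ i, 0 ≤ x i) (hy : ∀ j, 0 ≤ y j) :
    ∫⁻ s in Set.Ioi (0 : ℝ), chiSeries e f x y s * chiWeight s = entropySeries e f x y := by
  have := e.countable
  have := f.countable
  unfold chiSeries entropySeries
  rw [ENNReal.tsum_comm]
  simp_rw [← ENNReal.tsum_mul_right, mul_assoc]
  have hm : ∀ i j, Measurable fun s => ENNReal.ofReal (‖⟪e i, f j⟫_ℂ‖ ^ 2) *
      (chiTerm s (x i) (y j) * chiWeight s) := fun i j =>
    ((measurable_chiTerm _ _).mul measurable_chiWeight).const_mul _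
  rw [lintegral_tsum fun j => (Measurable.tsum fun i => hm i j).aemeasurable]
  refine tsum_congr fun j => ?_
  rw [lintegral_tsum fun i => (hm i j).aemeasurable]
  refine tsum_congr fun i => ?_
  rw [lintegral_const_mul _ (show Measurable fun s => chiTerm s (x i) (y j) * chiWeight s from
    (measurable_chiTerm _ _).mul measurable_chiWeight), lintegral_chiTerm (hx i) (hy j)]

theorem IsSpectralDecomposition.hasSum_inner {ι : Type*} {T : H →L[ℂ] H} {e : HilbertBasis ι ℂ H}
    {x : ι → ℝ} (h : IsSpectralDecomposition T e x) (u : H) :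
    HasSum (fun i => x i * ‖⟪e i, u⟫_ℂ‖ ^ 2) (RCLike.re ⟪u, T u⟫_ℂ) := by
  have h1 := (e.hasSum_inner_mul_inner u (T u)).mapL Complex.reCLM
  have h2 : (fun i => x i * ‖⟪e i, u⟫_ℂ‖ ^ 2) =
      fun i => Complex.reCLM (⟪u, e i⟫_ℂ * ⟪e i, T u⟫_ℂ) := by
    funext i
    rw [h.inner_map, mul_left_comm, ← inner_conj_symm u (e i), RCLike.conj_mul,
      Complex.reCLM_apply, Complex.re_ofReal_mul]
    norm_cast
  rw [h2]
  exact h1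

end ChiSeries

/-! ### Variational lower bound by finite-rank operators. -/

section ChiLowerBound

open Filter MeasureTheory

variable {H : Type*} [NormedAddCommGroup H] [InnerProductSpace ℂ H] [CompleteSpace H]
  {ι₀ κ₀ : Type*} (e₀ : HilbertBasis ι₀ ℂ H) (f₀ : HilbertBasis κ₀ ℂ H)
  (F : Finset ι₀) (G : Finset κ₀) (z : ι₀ → κ₀ → ℂ)

/-- The finite-rank operator with matrix elements `z i j`, `i ∈ F`, `j ∈ G`. -/
def finiteRank : H →L[ℂ] H :=
  ∑ i ∈ F, ∑ j ∈ G, z i j • InnerProductSpace.rankOne ℂ (e₀ i) (f₀ j)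

theorem finiteRank_apply (v : H) :
    finiteRank e₀ f₀ F G z v = ∑ i ∈ F, ∑ j ∈ G, (z i j * ⟪f₀ j, v⟫_ℂ) • e₀ i := by
  simp [finiteRank, sum_apply, smul_smul]

theorem star_finiteRank : star (finiteRank e₀ f₀ F G z) =
    finiteRank f₀ e₀ G F fun j i => starRingEnd ℂ (z i j) := by
  unfold finiteRank
  rw [Finset.sum_comm]
  simp [star_sum, ContinuousLinearMap.star_eq_adjoint]

theorem inner_finiteRank_left (u v : H) : ⟪finiteRank e₀ f₀ F G z u, v⟫_ℂ =
    ⟪u, star (finiteRank e₀ f₀ F G z) v⟫_ℂ := by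
  rw [ContinuousLinearMap.star_eq_adjoint, ContinuousLinearMap.adjoint_inner_right]

theorem finiteRank_basis [DecidableEq κ₀] {j : κ₀} :
    finiteRank e₀ f₀ F G z (f₀ j) = if j ∈ G then ∑ i ∈ F, z i j • e₀ i else 0 := by
  rw [finiteRank_apply]
  simp_rw [inner_basis_basis, mul_ite, mul_one, mul_zero, ite_smul, zero_smul, Finset.sum_ite_eq']
  split_ifs <;> simp

/-- The weak*-continuous affine minorant of `chiSeries` determined by a finite-rank operator. -/
def chiMinorant (s : ℝ) (X Y : H →L[ℂ] H) : ℝ :=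
  ∑ i ∈ F, ∑ j ∈ G, 2 * RCLike.re (starRingEnd ℂ (z i j) * ⟪e₀ i, (Y - X) (f₀ j)⟫_ℂ) -
    (∑ i ∈ F, RCLike.re ⟪star (finiteRank e₀ f₀ F G z) (e₀ i),
      Y (star (finiteRank e₀ f₀ F G z) (e₀ i))⟫_ℂ +
    s * ∑ j ∈ G, RCLike.re ⟪finiteRank e₀ f₀ F G z (f₀ j), X (finiteRank e₀ f₀ F G z (f₀ j))⟫_ℂ)

/-- Both sides compute `Tr Z Y Z†`: the left in the eigenbasis of `Y`, the right in `e₀`, where `Z†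
e₀ᵢ` vanishes for `i ∉ F`. -/
theorem tsum_eigenvalue_finiteRank {κ ι : Type*} {Y : H →L[ℂ] H} {f : HilbertBasis κ ℂ H}
    {y : κ → ℝ} (hY : IsSpectralDecomposition Y f y) (hp : Y.IsPositive) (e : HilbertBasis ι ℂ H) :
    ∑' (j : κ) (i : ι), ENNReal.ofReal (y j * ‖⟪e i, finiteRank e₀ f₀ F G z (f j)⟫_ℂ‖ ^ 2) =
      ENNReal.ofReal (∑ i ∈ F, RCLike.re ⟪star (finiteRank e₀ f₀ F G z) (e₀ i),
        Y (star (finiteRank e₀ f₀ F G z) (e₀ i))⟫_ℂ) := by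
  classical
  set Z := finiteRank e₀ f₀ F G z with hZ
  have hy := hY.nonneg hp
  calc ∑' (j : κ) (i : ι), ENNReal.ofReal (y j * ‖⟪e i, Z (f j)⟫_ℂ‖ ^ 2)
      = ∑' (j : κ) (i : ι₀), ENNReal.ofReal (y j * ‖⟪e₀ i, Z (f j)⟫_ℂ‖ ^ 2) := by
        refine tsum_congr fun j => ?_
        simp_rw [ENNReal.ofReal_mul (hy j), ENNReal.tsum_mul_left, tsum_sq_norm_inner]
    _ = ∑' (i : ι₀) (j : κ), ENNReal.ofReal (y j * ‖⟪f j, star Z (e₀ i)⟫_ℂ‖ ^ 2) := by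
        rw [ENNReal.tsum_comm]
        refine tsum_congr fun i => tsum_congr fun j => ?_
        rw [← inner_finiteRank_left, norm_inner_symm]
    _ = ∑' i : ι₀, ENNReal.ofReal (RCLike.re ⟪star Z (e₀ i), Y (star Z (e₀ i))⟫_ℂ) := by
        refine tsum_congr fun i => ?_
        have h := hY.hasSum_inner (star Z (e₀ i))
        rw [← ENNReal.ofReal_tsum_of_nonneg (fun j => mul_nonneg (hy j) (by positivity)) h.summable,
          h.tsum_eq]
    _ = ∑ i ∈ F, ENNReal.ofReal (RCLike.re ⟪star Z (e₀ i), Y (star Z (e₀ i))⟫_ℂ) := by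
        refine tsum_eq_sum fun i hi => ?_
        rw [hZ, star_finiteRank, finiteRank_basis, if_neg hi]
        simp
    _ = _ := (ENNReal.ofReal_sum_of_nonneg fun i _ => hp.re_inner_nonneg_right _).symm

/-- Completing the square. At `d = 0` the quotient is `0`, so `c` must vanish there. -/
theorem two_re_mul_le {w c : ℂ} {d : ℝ} (hd : 0 ≤ d) (hc : d = 0 → c = 0) :
    |2 * (starRingEnd ℂ w * c).re| ≤ d * ‖w‖ ^ 2 + ‖c‖ ^ 2 / d := by
  have h1 : |2 * (starRingEnd ℂ w * c).re| ≤ 2 * (‖w‖ * ‖c‖) := by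
    rw [abs_mul, abs_two]
    have := Complex.abs_re_le_norm (starRingEnd ℂ w * c)
    rw [norm_mul, RCLike.norm_conj] at this
    linarith
  refine h1.trans ?_
  rcases hd.eq_or_lt with h | h
  · rw [hc h.symm, ← h]
    simp
  · have h3 : d * ‖w‖ ^ 2 + ‖c‖ ^ 2 / d - 2 * (‖w‖ * ‖c‖) = (d * ‖w‖ - ‖c‖) ^ 2 / d := by
      field_simp
      ring
    have : 0 ≤ (d * ‖w‖ - ‖c‖) ^ 2 / d := by positivity
    linarith

theorem summable_of_tsum_ofReal {α β : Type*} {g : α → β → ℝ} (hg : ∀ a b, 0 ≤ g a b)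
    (h : ∑' (a) (b), ENNReal.ofReal (g a b) ≠ ∞) :
    (Summable fun p : α × β => g p.1 p.2) ∧
      ENNReal.ofReal (∑' p : α × β, g p.1 p.2) = ∑' (a) (b), ENNReal.ofReal (g a b) := by
  rw [← ENNReal.tsum_prod] at h ⊢
  have hs : Summable fun p : α × β => g p.1 p.2 :=
    (ENNReal.summable_toReal h).congr fun p => (ENNReal.toReal_ofReal (hg _ _))
  exact ⟨hs, ENNReal.ofReal_tsum_of_nonneg (fun p => hg _ _) hs⟩

/-- The linear term `2 Re Tr Z† D` may be evaluated in any basis `f`, in particular in the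
eigenbasis of `Y`. -/
theorem hasSum_inner_finiteRank {κ : Type*} (f : HilbertBasis κ ℂ H) {D : H →L[ℂ] H}
    (hD : (D : H →ₗ[ℂ] H).IsSymmetric) :
    HasSum (fun l => 2 * (⟪finiteRank e₀ f₀ F G z (f l), D (f l)⟫_ℂ).re)
      (∑ i ∈ F, ∑ j ∈ G, 2 * RCLike.re (starRingEnd ℂ (z i j) * ⟪e₀ i, D (f₀ j)⟫_ℂ)) := by
  have h1 : ∀ i j, HasSum (fun l => 2 * RCLike.re (starRingEnd ℂ (z i j) *
      (⟪D (e₀ i), f l⟫_ℂ * ⟪f l, f₀ j⟫_ℂ)))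
      (2 * RCLike.re (starRingEnd ℂ (z i j) * ⟪e₀ i, D (f₀ j)⟫_ℂ)) := fun i j => by
    have h := (((f.hasSum_inner_mul_inner (D (e₀ i)) (f₀ j)).mul_left
      (starRingEnd ℂ (z i j))).mapL Complex.reCLM).mul_left 2
    rw [show ⟪D (e₀ i), f₀ j⟫_ℂ = ⟪e₀ i, D (f₀ j)⟫_ℂ from hD _ _] at h
    exact h
  have h2 : (fun l => 2 * (⟪finiteRank e₀ f₀ F G z (f l), D (f l)⟫_ℂ).re) = fun l =>
      ∑ i ∈ F, ∑ j ∈ G, 2 * RCLike.re (starRingEnd ℂ (z i j) *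
        (⟪D (e₀ i), f l⟫_ℂ * ⟪f l, f₀ j⟫_ℂ)) := by
    funext l
    rw [finiteRank_apply]
    simp_rw [sum_inner, inner_smul_left, Complex.re_sum, Finset.mul_sum]
    refine Finset.sum_congr rfl fun i _ => Finset.sum_congr rfl fun j _ => ?_
    rw [map_mul, inner_conj_symm, mul_assoc, mul_comm ⟪f l, f₀ j⟫_ℂ,
      show ⟪D (e₀ i), f l⟫_ℂ = ⟪e₀ i, D (f l)⟫_ℂ from hD _ _]
    rfl
  rw [h2]
  exact hasSum_sum fun i _ => hasSum_sum fun j _ => h1 i j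

/-- In the eigenbases, `⟪eₖ, (Y - X) fₗ⟫ = (yₗ - xₖ) ⟪eₖ, fₗ⟫`, so `two_re_mul_le` with `d = yₗ + s
xₖ` bounds the expression term by term. The eigenbases need not be related to `e₀, f₀`, so one fixed
`Z` works along a whole sequence of operators. -/
theorem chiMinorant_le {ι κ : Type*} {e : HilbertBasis ι ℂ H} {f : HilbertBasis κ ℂ H}
    {x : ι → ℝ} {y : κ → ℝ} {X Y : H →L[ℂ] H} (hX : IsSpectralDecomposition X e x)
    (hY : IsSpectralDecomposition Y f y) (hXp : X.IsPositive) (hYp : Y.IsPositive) {s : ℝ}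
    (hs : 0 < s) : ENNReal.ofReal (chiMinorant e₀ f₀ F G z s X Y) ≤ chiSeries e f x y s := by
  rcases eq_or_ne (chiSeries e f x y s) ∞ with htop | htop
  · rw [htop]
    exact le_top
  have hx := hX.nonneg hXp
  have hy := hY.nonneg hYp
  set Z := finiteRank e₀ f₀ F G z with hZ
  have hq0 : ∀ l k, 0 ≤ ‖⟪e k, f l⟫_ℂ‖ ^ 2 * ((y l - x k) ^ 2 / (y l + s * x k)) := fun l k => by
    have := hx k
    have := hy l
    positivity
  have hchi : chiSeries e f x y s = ∑' (l) (k),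
      ENNReal.ofReal (‖⟪e k, f l⟫_ℂ‖ ^ 2 * ((y l - x k) ^ 2 / (y l + s * x k))) := by
    unfold chiSeries chiTerm
    simp_rw [ENNReal.ofReal_mul (sq_nonneg ‖_‖)]
  rw [hchi] at htop
  obtain ⟨hqs, hqt⟩ := summable_of_tsum_ofReal hq0 htop
  have hYt := tsum_eigenvalue_finiteRank e₀ f₀ F G z hY hYp e
  have hXt := tsum_eigenvalue_finiteRank f₀ e₀ G F (fun j i => starRingEnd ℂ (z i j)) hX hXp f
  rw [← star_finiteRank, star_star] at hXt
  obtain ⟨hYs, hYt'⟩ := summable_of_tsum_ofReal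
    (fun l k => mul_nonneg (hy l) (sq_nonneg ‖⟪e k, Z (f l)⟫_ℂ‖))
      (by rw [hYt]; exact ENNReal.ofReal_ne_top)
  have hXt2 : ∑' (l) (k), ENNReal.ofReal (x k * ‖⟪e k, Z (f l)⟫_ℂ‖ ^ 2) =
      ENNReal.ofReal (∑ j ∈ G, RCLike.re ⟪Z (f₀ j), X (Z (f₀ j))⟫_ℂ) := by
    rw [← hXt, ENNReal.tsum_comm]
    refine tsum_congr fun k => tsum_congr fun l => ?_
    rw [← inner_finiteRank_left, norm_inner_symm]
  obtain ⟨hXs, hXt'⟩ := summable_of_tsum_ofReal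
    (fun l k => mul_nonneg (hx k) (sq_nonneg ‖⟪e k, Z (f l)⟫_ℂ‖))
      (by rw [hXt2]; exact ENNReal.ofReal_ne_top)
  rw [hYt, ENNReal.ofReal_eq_ofReal_iff (tsum_nonneg fun _ => mul_nonneg (hy _) (sq_nonneg _))
    (Finset.sum_nonneg fun _ _ => hYp.re_inner_nonneg_right _)] at hYt'
  rw [hXt2, ENNReal.ofReal_eq_ofReal_iff (tsum_nonneg fun _ => mul_nonneg (hx _) (sq_nonneg _))
    (Finset.sum_nonneg fun _ _ => hXp.re_inner_nonneg_right _)] at hXt'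
  set r : κ × ι → ℝ := fun p => 2 * (starRingEnd ℂ ⟪e p.2, Z (f p.1)⟫_ℂ *
    ⟪e p.2, (Y - X) (f p.1)⟫_ℂ).re with hr
  have hc : ∀ l k, ⟪e k, (Y - X) (f l)⟫_ℂ = ((y l - x k : ℝ) : ℂ) * ⟪e k, f l⟫_ℂ := fun l k => by
    rw [sub_apply, inner_sub_right, hY l, inner_smul_right, hX.inner_map, ← sub_mul]
    push_cast
    rfl
  have hbound : ∀ p, |r p| ≤ (y p.1 * ‖⟪e p.2, Z (f p.1)⟫_ℂ‖ ^ 2 +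
      s * (x p.2 * ‖⟪e p.2, Z (f p.1)⟫_ℂ‖ ^ 2)) +
      ‖⟪e p.2, f p.1⟫_ℂ‖ ^ 2 * ((y p.1 - x p.2) ^ 2 / (y p.1 + s * x p.2)) := by
    intro p
    have hx' := hx p.2
    have hy' := hy p.1
    refine (two_re_mul_le (d := y p.1 + s * x p.2) (by positivity) fun h0 => ?_).trans (le_of_eq ?_)
    · have h1 : y p.1 = 0 := by nlinarith
      have h2 : x p.2 = 0 := by nlinarith
      rw [hc, h1, h2]
      simp
    · rw [hc, norm_mul, Complex.norm_real, mul_pow, Real.norm_eq_abs, sq_abs]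
      ring
  -- Finiteness of the series and of both quadratic traces gives a summable majorant, which allows
  -- real-valued rearrangement of the signed terms.
  have hmaj := (hYs.add (hXs.mul_left s)).add hqs
  have hrs : Summable r := Summable.of_norm_bounded hmaj fun p => hbound p
  have hrt : ∑' p, r p = ∑ i ∈ F, ∑ j ∈ G,
      2 * RCLike.re (starRingEnd ℂ (z i j) * ⟪e₀ i, (Y - X) (f₀ j)⟫_ℂ) := by
    rw [hrs.tsum_prod, ← (hasSum_inner_finiteRank e₀ f₀ F G z f (D := Y - X)
      (fun u v => by
        simp only [ContinuousLinearMap.coe_coe, sub_apply, inner_sub_left, inner_sub_right]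
        rw [hYp.inner_left_eq_inner_right, hXp.inner_left_eq_inner_right])).tsum_eq]
    refine tsum_congr fun l => ?_
    have h := ((e.hasSum_inner_mul_inner (Z (f l)) ((Y - X) (f l))).mapL Complex.reCLM).mul_left 2
    rw [Complex.reCLM_apply] at h
    rw [← h.tsum_eq]
    refine tsum_congr fun k => ?_
    simp only [hr, Complex.reCLM_apply, inner_conj_symm]
  have hle : ∑' p, r p ≤ _ := hrs.tsum_le_tsum (fun p => (le_abs_self _).trans (hbound p)) hmaj
  rw [hrt, (hYs.add (hXs.mul_left s)).tsum_add hqs, hYs.tsum_add (hXs.mul_left s), tsum_mul_left,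
    hXt', hYt'] at hle
  rw [hchi, ← hqt]
  refine ENNReal.ofReal_le_ofReal ?_
  rw [chiMinorant]
  linarith

/-- The optimiser `c / d` of each completed square, cut off to `F × G`, turns the minorant into a
partial sum of the series. -/
theorem chiMinorant_eq {x : ι₀ → ℝ} {y : κ₀ → ℝ} {X Y : H →L[ℂ] H}
    (hX : IsSpectralDecomposition X e₀ x) (hY : IsSpectralDecomposition Y f₀ y)
    (hXp : X.IsPositive) (hYp : Y.IsPositive) {s : ℝ} (hs : 0 < s) :
    chiMinorant e₀ f₀ F G (fun i j => ((y j - x i) / (y j + s * x i) : ℝ) * ⟪e₀ i, f₀ j⟫_ℂ) s X Y =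
      ∑ i ∈ F, ∑ j ∈ G, ‖⟪e₀ i, f₀ j⟫_ℂ‖ ^ 2 * ((y j - x i) ^ 2 / (y j + s * x i)) := by
  classical
  set z : ι₀ → κ₀ → ℂ := fun i j => ((y j - x i) / (y j + s * x i) : ℝ) * ⟪e₀ i, f₀ j⟫_ℂ with hz
  have h1 : ∀ i ∈ F, RCLike.re ⟪star (finiteRank e₀ f₀ F G z) (e₀ i),
      Y (star (finiteRank e₀ f₀ F G z) (e₀ i))⟫_ℂ = ∑ j ∈ G, y j * ‖z i j‖ ^ 2 := by
    intro i hi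
    rw [star_finiteRank, finiteRank_basis, if_pos hi]
    simp_rw [map_sum, map_smul, hY _, smul_smul]
    rw [f₀.orthonormal.inner_sum, map_sum]
    refine Finset.sum_congr rfl fun j _ => ?_
    rw [← mul_assoc, RCLike.conj_mul, RCLike.norm_conj, mul_comm, RCLike.re_to_complex,
      Complex.re_ofReal_mul]
    norm_cast
  have h2 : ∀ j ∈ G, RCLike.re ⟪finiteRank e₀ f₀ F G z (f₀ j),
      X (finiteRank e₀ f₀ F G z (f₀ j))⟫_ℂ = ∑ i ∈ F, x i * ‖z i j‖ ^ 2 := by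
    intro j hj
    rw [finiteRank_basis, if_pos hj]
    simp_rw [map_sum, map_smul, hX _, smul_smul]
    rw [e₀.orthonormal.inner_sum, map_sum]
    refine Finset.sum_congr rfl fun i _ => ?_
    rw [← mul_assoc, RCLike.conj_mul, mul_comm, RCLike.re_to_complex, Complex.re_ofReal_mul]
    norm_cast
  rw [chiMinorant, Finset.sum_congr rfl h1, Finset.sum_congr rfl h2, Finset.sum_comm (s := G),
    Finset.mul_sum, ← Finset.sum_add_distrib, ← Finset.sum_sub_distrib]
  refine Finset.sum_congr rfl fun i _ => ?_
  rw [Finset.mul_sum, ← Finset.sum_add_distrib, ← Finset.sum_sub_distrib]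
  refine Finset.sum_congr rfl fun j _ => ?_
  have hx' := hX.nonneg hXp i
  have hy' := hY.nonneg hYp j
  have hc : ⟪e₀ i, (Y - X) (f₀ j)⟫_ℂ = ((y j - x i : ℝ) : ℂ) * ⟪e₀ i, f₀ j⟫_ℂ := by
    rw [sub_apply, inner_sub_right, hY j, inner_smul_right, hX.inner_map, ← sub_mul]
    push_cast
    rfl
  have h3 : starRingEnd ℂ (z i j) * ⟪e₀ i, (Y - X) (f₀ j)⟫_ℂ =
      (((y j - x i) / (y j + s * x i) * (y j - x i) * ‖⟪e₀ i, f₀ j⟫_ℂ‖ ^ 2 : ℝ) : ℂ) := by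
    rw [hc, hz]
    simp only [map_mul, Complex.conj_ofReal]
    rw [mul_mul_mul_comm, RCLike.conj_mul]
    push_cast
    rfl
  rw [h3, RCLike.re_to_complex, Complex.ofReal_re, hz]
  simp only [norm_mul, Complex.norm_real, mul_pow, Real.norm_eq_abs, sq_abs]
  rcases (show 0 ≤ y j + s * x i by positivity).eq_or_lt with h0 | h0
  · rw [← h0]
    simp
  · field_simp
    ring

end ChiLowerBound

/-! ### Joint lower semi-continuity of the relative entropy. -/

section LowerSemicontinuity

open Filter MeasureTheory

variable {H : Type*} [NormedAddCommGroup H] [InnerProductSpace ℂ H] [CompleteSpace H]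

theorem chiSeries_le {ι κ : Type*} {e : HilbertBasis ι ℂ H} {f : HilbertBasis κ ℂ H}
    {x : ι → ℝ} {y : κ → ℝ} {s : ℝ} (hx : ∀ i, 0 ≤ x i) (hy : ∀ j, 0 ≤ y j) (hs : 0 < s)
    {L : ℝ≥0∞} (h : ∀ F G, ENNReal.ofReal (∑ i ∈ F, ∑ j ∈ G,
      ‖⟪e i, f j⟫_ℂ‖ ^ 2 * ((y j - x i) ^ 2 / (y j + s * x i))) ≤ L) :
    chiSeries e f x y s ≤ L := by
  classical
  unfold chiSeries
  rw [ENNReal.tsum_comm, ← ENNReal.tsum_prod, ENNReal.tsum_eq_iSup_sum]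
  refine iSup_le fun t => le_trans ?_ (h (t.image Prod.fst) (t.image Prod.snd))
  have hnn : ∀ i j, 0 ≤ ‖⟪e i, f j⟫_ℂ‖ ^ 2 * ((y j - x i) ^ 2 / (y j + s * x i)) := fun i j => by
    have := hx i
    have := hy j
    positivity
  rw [ENNReal.ofReal_sum_of_nonneg fun i _ => Finset.sum_nonneg fun j _ => hnn i j]
  simp_rw [ENNReal.ofReal_sum_of_nonneg fun j _ => hnn _ j]
  rw [← Finset.sum_product']
  simp_rw [chiTerm, ← ENNReal.ofReal_mul (sq_nonneg ‖_‖)]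
  exact Finset.sum_le_sum_of_subset Finset.subset_product

theorem tendsto_chiMinorant {ι₀ κ₀ : Type*} (e₀ : HilbertBasis ι₀ ℂ H) (f₀ : HilbertBasis κ₀ ℂ H)
    (F : Finset ι₀) (G : Finset κ₀) (z : ι₀ → κ₀ → ℂ) (s : ℝ) {X Y : H →L[ℂ] H}
    {X' Y' : ℕ → H →L[ℂ] H} (hX : ∀ u v, Tendsto (fun n => ⟪u, X' n v⟫_ℂ) atTop (𝓝 ⟪u, X v⟫_ℂ))
    (hY : ∀ u v, Tendsto (fun n => ⟪u, Y' n v⟫_ℂ) atTop (𝓝 ⟪u, Y v⟫_ℂ)) :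
    Tendsto (fun n => chiMinorant e₀ f₀ F G z s (X' n) (Y' n)) atTop
      (𝓝 (chiMinorant e₀ f₀ F G z s X Y)) := by
  have hre : ∀ {a : ℕ → ℂ} {b : ℂ}, Tendsto a atTop (𝓝 b) →
      Tendsto (fun n => RCLike.re (a n)) atTop (𝓝 (RCLike.re b)) := fun h =>
    (Complex.continuous_re.tendsto _).comp h
  unfold chiMinorant
  refine .sub (tendsto_finsetSum _ fun i _ => tendsto_finsetSum _ fun j _ => ?_)
    (.add (tendsto_finsetSum _ fun i _ => hre (hY _ _))
      (.const_mul _ (tendsto_finsetSum _ fun j _ => hre (hX _ _))))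
  simp_rw [sub_apply, inner_sub_right]
  exact (hre (((hY _ _).sub (hX _ _)).const_mul _)).const_mul _

/-- The relative entropy is lower semi-continuous with respect to the convergence of matrix
elements. -/
theorem relEntropy_le_liminf [TopologicalSpace.SeparableSpace H] {X Y : H →L[ℂ] H}
    {X' Y' : ℕ → H →L[ℂ] H} (hXp : X.IsPositive) (hYp : Y.IsPositive) (hXt : IsTraceClass X)
    (hYt : IsTraceClass Y) (hXp' : ∀ n, (X' n).IsPositive) (hYp' : ∀ n, (Y' n).IsPositive)
    (hXt' : ∀ n, IsTraceClass (X' n)) (hYt' : ∀ n, IsTraceClass (Y' n))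
    (hX : ∀ u v, Tendsto (fun n => ⟪u, X' n v⟫_ℂ) atTop (𝓝 ⟪u, X v⟫_ℂ))
    (hY : ∀ u v, Tendsto (fun n => ⟪u, Y' n v⟫_ℂ) atTop (𝓝 ⟪u, Y v⟫_ℂ)) :
    relEntropy X Y ≤ liminf (fun n => relEntropy (X' n) (Y' n)) atTop := by
  obtain ⟨σ, e, x, hex⟩ := exists_spectralDecomposition hXp hXt
  obtain ⟨τ, f, y, hfy⟩ := exists_spectralDecomposition hYp hYt
  choose σ' e' x' hex' using fun n => exists_spectralDecomposition (hXp' n) (hXt' n)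
  choose τ' f' y' hfy' using fun n => exists_spectralDecomposition (hYp' n) (hYt' n)
  have hx := hex.nonneg hXp
  have hy := hfy.nonneg hYp
  rw [relEntropy_eq hex hfy, ← lintegral_chiSeries e f hx hy]
  have h1 : ∀ n, relEntropy (X' n) (Y' n) = ∫⁻ s in Set.Ioi (0 : ℝ),
      chiSeries (e' n) (f' n) (x' n) (y' n) s * chiWeight s := fun n => by
    rw [relEntropy_eq (hex' n) (hfy' n), lintegral_chiSeries (e' n) (f' n)
      ((hex' n).nonneg (hXp' n)) ((hfy' n).nonneg (hYp' n))]
  simp_rw [h1]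
  -- Fatou's lemma reduces the claim to each fixed `s > 0`.
  refine le_trans ?_ (lintegral_liminf_le fun n =>
    (measurable_chiSeries (e' n) (f' n) (x' n) (y' n)).mul measurable_chiWeight)
  refine setLIntegral_mono' measurableSet_Ioi fun s hs => ?_
  have hs : 0 < s := hs
  have key : chiSeries e f x y s ≤
      liminf (fun n => chiSeries (e' n) (f' n) (x' n) (y' n) s) atTop := by
    refine chiSeries_le hx hy hs fun F G => ?_
    -- The minorant that is optimal for the limit pair is kept fixed: it converges along the
    -- sequence and stays below each series.
    rw [← chiMinorant_eq e f F G hex hfy hXp hYp hs]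
    have hlim := (ENNReal.continuous_ofReal.tendsto _).comp
      (tendsto_chiMinorant e f F G (fun i j => ((y j - x i) / (y j + s * x i) : ℝ) * ⟪e i, f j⟫_ℂ)
        s hX hY)
    rw [← hlim.liminf_eq]
    refine liminf_le_liminf (Eventually.of_forall fun n => ?_)
    exact chiMinorant_le e f F G _ (hex' n) (hfy' n) (hXp' n) (hYp' n) hs
  refine (mul_le_mul_left key _).trans ?_
  rw [ENNReal.liminf_mul_const_of_ne_top]
  · exact (mul_comm _ _).le
  · exact ENNReal.ofReal_ne_top

end LowerSemicontinuity

/-! ### Sequential weak compactness of bounded sets of operators. -/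

section Compactness

open Filter

variable {H : Type*} [NormedAddCommGroup H] [InnerProductSpace ℂ H] [CompleteSpace H]

theorem cauchySeq_of_dense {H : Type*} [NormedAddCommGroup H] {f : ℕ → H → ℂ} {C : ℝ}
    (hf : ∀ n u v, ‖f n u - f n v‖ ≤ C * ‖u - v‖) {D : Set H} (hD : Dense D)
    (h : ∀ d ∈ D, CauchySeq fun n => f n d) (v : H) : CauchySeq fun n => f n v := by
  rw [Metric.cauchySeq_iff']
  intro ε hε
  have hC : 0 < |C| + 1 := by positivity
  obtain ⟨d, hd, hvd⟩ := Metric.mem_closure_iff.1 (hD v) (ε / 3 / (|C| + 1)) (by positivity)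
  obtain ⟨N, hN⟩ := Metric.cauchySeq_iff'.1 (h d hd) (ε / 3) (by positivity)
  refine ⟨N, fun n hn => ?_⟩
  have h1 : ∀ n, ‖f n v - f n d‖ < ε / 3 := fun n => by
    rw [dist_eq_norm, lt_div_iff₀ hC] at hvd
    have := le_abs_self C
    have h2 := norm_nonneg (v - d)
    refine (hf n v d).trans_lt ?_
    nlinarith
  have h2 := hN n hn
  have h3 := h1 N
  rw [norm_sub_rev] at h3
  rw [dist_eq_norm] at h2 ⊢
  have h4 : f n v - f N v = (f n v - f n d) + (f n d - f N d) + (f N d - f N v) := by ring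
  rw [h4]
  calc _ ≤ ‖f n v - f n d‖ + ‖f n d - f N d‖ + ‖f N d - f N v‖ := norm_add₃_le
    _ < ε := by linarith [h1 n]

/-- A bounded sequence of operators has a subsequence whose matrix elements converge. -/
theorem exists_subseq_tendsto_inner [TopologicalSpace.SeparableSpace H] {X : ℕ → H →L[ℂ] H}
    (hX : ∀ n, ‖X n‖ ≤ 1) : ∃ φ : ℕ → ℕ, StrictMono φ ∧ ∃ T : H →L[ℂ] H,
      ∀ u v, Tendsto (fun n => ⟪u, X (φ n) v⟫_ℂ) atTop (𝓝 ⟪u, T v⟫_ℂ) := by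
  set d := TopologicalSpace.denseSeq H with hd
  have hdd : Dense (Set.range d) := TopologicalSpace.denseRange_denseSeq H
  have hb : ∀ n u v, ‖⟪X n u, v⟫_ℂ‖ ≤ ‖u‖ * ‖v‖ := fun n u v =>
    (norm_inner_le_norm _ _).trans (by
      gcongr
      exact ((X n).le_opNorm u).trans (mul_le_of_le_one_left (norm_nonneg _) (hX n)))
  -- Sequential compactness of a countable product of discs replaces the diagonal argument over
  -- pairs from a dense sequence; equicontinuity then extends convergence to all vectors.
  have hcomp : IsCompact (Set.univ.pi fun p : ℕ × ℕ =>
      Metric.closedBall (0 : ℂ) (‖d p.1‖ * ‖d p.2‖)) :=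
    isCompact_univ_pi fun p => isCompact_closedBall _ _
  obtain ⟨a, -, φ, hφ, ha⟩ := hcomp.tendsto_subseq
    (x := fun n p => ⟪X n (d p.1), d p.2⟫_ℂ) fun n p _ => by
      rw [mem_closedBall_zero_iff]
      exact hb n _ _
  rw [tendsto_pi_nhds] at ha
  have h1 : ∀ k v, CauchySeq fun n => ⟪X (φ n) (d k), v⟫_ℂ := fun k v => by
    refine cauchySeq_of_dense (C := ‖d k‖) (fun n u v => ?_) hdd ?_ v
    · rw [← inner_sub_right]
      exact hb _ _ _
    · rintro _ ⟨l, rfl⟩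
      exact (ha (k, l)).cauchySeq
  have h2 : ∀ u v, CauchySeq fun n => ⟪X (φ n) u, v⟫_ℂ := fun u v => by
    refine cauchySeq_of_dense (f := fun n u => ⟪X (φ n) u, v⟫_ℂ) (C := ‖v‖) (fun n u w => ?_) hdd
      ?_ u
    · rw [← inner_sub_left, ← map_sub, mul_comm]
      exact hb _ _ _
    · rintro _ ⟨k, rfl⟩
      exact h1 k v
  choose B hB using fun u v => cauchySeq_tendsto_of_complete (h2 u v)
  -- The limits form a bounded sesquilinear form, which is represented by an operator.
  let B' : H →ₗ⋆[ℂ] H →ₗ[ℂ] ℂ := LinearMap.mk₂'ₛₗ (starRingEnd ℂ) (RingHom.id ℂ) B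
    (fun u u' v => tendsto_nhds_unique (hB _ _) (((hB u v).add (hB u' v)).congr fun n => by
      rw [map_add, inner_add_left]))
    (fun c u v => tendsto_nhds_unique (hB _ _) (((hB u v).const_mul (starRingEnd ℂ c)).congr
      fun n => by rw [map_smul, inner_smul_left]))
    (fun u v v' => tendsto_nhds_unique (hB _ _) (((hB u v).add (hB u v')).congr fun n => by
      rw [inner_add_right]))
    (fun c u v => tendsto_nhds_unique (hB _ _) (((hB u v).const_mul c).congr
      fun n => by rw [inner_smul_right]))
  have hB' : ∀ u v, ‖B' u v‖ ≤ 1 * ‖u‖ * ‖v‖ := fun u v => by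
    rw [one_mul]
    exact le_of_tendsto (hB u v).norm (Eventually.of_forall fun n => hb _ _ _)
  let T : H →L[ℂ] H := InnerProductSpace.continuousLinearMapOfBilin (B'.mkContinuous₂ 1 hB')
  refine ⟨φ, hφ, T, fun u v => ?_⟩
  have h3 : ⟪T v, u⟫_ℂ = B v u := InnerProductSpace.continuousLinearMapOfBilin_apply _ _ _
  rw [← inner_conj_symm, h3]
  refine ((Complex.continuous_conj.tendsto _).comp (hB v u)).congr fun n => ?_
  exact inner_conj_symm _ _

end Compactness

/-! ### Weak limits of states, and rescaling the second argument of `D`. -/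

section States

open Filter

variable {H : Type*} [NormedAddCommGroup H] [InnerProductSpace ℂ H] [CompleteSpace H]

theorem norm_le_one_of_traceNorm_le_one {T : H →L[ℂ] H} (hT : traceNorm T ≤ 1) : ‖T‖ ≤ 1 := by
  refine T.opNorm_le_bound zero_le_one fun x => ?_
  rw [one_mul]
  rcases eq_or_ne (T x) 0 with h0 | h0
  · rw [h0, norm_zero]
    exact norm_nonneg x
  · have h := (ofReal_norm_inner_le T (T x) x).trans (mul_le_of_le_one_right zero_le hT)
    rw [ENNReal.ofReal_le_ofReal_iff (by positivity), inner_self_eq_norm_sq_to_K, norm_pow,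
      RCLike.norm_ofReal, abs_norm, sq] at h
    exact le_of_mul_le_mul_left h (norm_pos_iff.2 h0)

theorem isPositive_of_tendsto_inner {X : ℕ → H →L[ℂ] H} {T : H →L[ℂ] H}
    (hX : ∀ n, (X n).IsPositive)
    (h : ∀ u v, Tendsto (fun n => ⟪u, X n v⟫_ℂ) atTop (𝓝 ⟪u, T v⟫_ℂ)) : T.IsPositive := by
  refine isPositive_of_approx fun x ε hε => ?_
  obtain ⟨n, hn⟩ := ((Metric.tendsto_nhds.1 (h x x)) ε hε).exists
  refine ⟨X n, hX n, ?_⟩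
  rwa [dist_comm, dist_eq_norm, ← inner_sub_right, ← sub_apply] at hn

/-- Finite partial sums of the diagonal converge, so the trace can drop in the limit but not grow.
-/
theorem traceNorm_le_of_tendsto_inner {X : ℕ → H →L[ℂ] H} {T : H →L[ℂ] H}
    (hX : ∀ n, (X n).IsPositive) (hX' : ∀ n, traceNorm (X n) ≤ 1)
    (h : ∀ u v, Tendsto (fun n => ⟪u, X n v⟫_ℂ) atTop (𝓝 ⟪u, T v⟫_ℂ)) : traceNorm T ≤ 1 := by
  rw [traceNorm_of_isPositive (someBasis H) (isPositive_of_tendsto_inner hX h),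
    ENNReal.tsum_eq_iSup_sum]
  refine iSup_le fun F => ?_
  have hlim : Tendsto (fun n => ∑ i ∈ F,
      ENNReal.ofReal (RCLike.re ⟪someBasis H i, X n (someBasis H i)⟫_ℂ)) atTop
      (𝓝 (∑ i ∈ F, ENNReal.ofReal (RCLike.re ⟪someBasis H i, T (someBasis H i)⟫_ℂ))) :=
    tendsto_finsetSum _ fun i _ => (ENNReal.continuous_ofReal.tendsto _).comp
      ((Complex.continuous_re.tendsto _).comp (h _ _))
  refine le_of_tendsto hlim (Eventually.of_forall fun n => ?_)
  refine le_trans ?_ (hX' n)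
  rw [traceNorm_of_isPositive (someBasis H) (hX n)]
  exact ENNReal.sum_le_tsum F

theorem tendsto_inner_of_tendsto_traceNorm {X : ℕ → H →L[ℂ] H} {T : H →L[ℂ] H}
    (h : Tendsto (fun n => traceNorm (X n - T)) atTop (𝓝 0)) (u v : H) :
    Tendsto (fun n => ⟪u, X n v⟫_ℂ) atTop (𝓝 ⟪u, T v⟫_ℂ) := by
  rw [Metric.tendsto_nhds]
  intro ε hε
  have hpos : 0 < ENNReal.ofReal (ε / (‖u‖ * ‖v‖ + 1)) := ENNReal.ofReal_pos.2 (by positivity)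
  filter_upwards [(tendsto_order.1 h).2 _ hpos] with n hn
  rw [dist_eq_norm, ← inner_sub_right, ← sub_apply]
  exact norm_inner_lt_of_traceNorm_lt hn

theorem entropy_nonneg {x y : ℝ} (hx : 0 < x) (hy : 0 < y) :
    0 ≤ x * Real.log x - x * Real.log y + y - x := by
  have h := Real.log_le_sub_one_of_pos (div_pos hy hx)
  rw [Real.log_div hy.ne' hx.ne'] at h
  have h2 := mul_le_mul_of_nonneg_left h hx.le
  have h3 : x * (y / x - 1) = y - x := by field_simp
  rw [h3] at h2
  linarith

/-- The scaling identity is arranged so that all terms are non-negative, since subtraction in `ℝ≥0∞`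
truncates. -/
theorem entropyTerm_mul {x y c : ℝ} (hx : 0 ≤ x) (hy : 0 ≤ y) (hc : 0 < c) (hc1 : c ≤ 1) :
    entropyTerm x (c * y) + ENNReal.ofReal ((1 - c) * y) =
      entropyTerm x y + ENNReal.ofReal (-Real.log c * x) := by
  have hlog : 0 ≤ -Real.log c := neg_nonneg.2 (Real.log_nonpos hc.le hc1)
  unfold entropyTerm
  rcases hx.eq_or_lt with rfl | hx
  · rw [if_pos rfl, if_pos rfl, ← ENNReal.ofReal_add (by positivity)
      (mul_nonneg (by linarith) hy)]
    simp [sub_mul]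
  rw [if_neg hx.ne', if_neg hx.ne']
  rcases hy.eq_or_lt with rfl | hy
  · simp
  rw [if_neg hy.ne', if_neg (mul_pos hc hy).ne',
    ← ENNReal.ofReal_add (entropy_nonneg hx (mul_pos hc hy)) (mul_nonneg (by linarith) hy.le),
    ← ENNReal.ofReal_add (entropy_nonneg hx hy) (by positivity), Real.log_mul hc.ne' hy.ne']
  congr 1
  ring

/-- The overlaps `|⟨eᵢ, fⱼ⟩|²` form a doubly stochastic matrix. -/
theorem tsum_overlap_mul_right {ι κ : Type*} (e : HilbertBasis ι ℂ H) (f : HilbertBasis κ ℂ H)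
    (g : κ → ℝ≥0∞) :
    ∑' (i) (j), ENNReal.ofReal (‖⟪e i, f j⟫_ℂ‖ ^ 2) * g j = ∑' j, g j := by
  rw [ENNReal.tsum_comm]
  refine tsum_congr fun j => ?_
  rw [ENNReal.tsum_mul_right, tsum_sq_norm_inner, f.orthonormal.1 j]
  simp

theorem tsum_overlap_mul_left {ι κ : Type*} (e : HilbertBasis ι ℂ H) (f : HilbertBasis κ ℂ H)
    (g : ι → ℝ≥0∞) :
    ∑' (i) (j), ENNReal.ofReal (‖⟪e i, f j⟫_ℂ‖ ^ 2) * g i = ∑' i, g i := by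
  refine tsum_congr fun i => ?_
  simp_rw [norm_inner_symm (𝕜 := ℂ) (e i)]
  rw [ENNReal.tsum_mul_right, tsum_sq_norm_inner, e.orthonormal.1 i]
  simp

/-- Summing the scaling identity gives `D(ρ‖cσ) + (1 - c) = D(ρ‖σ) - ln c`, and `1 - c ≤ -ln c`.
This repairs the loss of trace in weak limits. -/
theorem relEntropy_le_relEntropy_smul {ρ σ : H →L[ℂ] H} (hρ : IsState ρ) (hσ : IsState σ) {c : ℝ}
    (hc : 0 < c) (hc1 : c ≤ 1) : relEntropy ρ σ ≤ relEntropy ρ (c • σ) := by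
  obtain ⟨S, e, x, hex⟩ := exists_spectralDecomposition hρ.1 hρ.2.1
  obtain ⟨T, f, y, hfy⟩ := exists_spectralDecomposition hσ.1 hσ.2.1
  have hfy' : IsSpectralDecomposition (c • σ) f fun j => c * y j := fun j => by
    rw [smul_apply, hfy j, ← Complex.coe_smul, smul_smul]
    push_cast
    rfl
  have hx := hex.nonneg hρ.1
  have hy := hfy.nonneg hσ.1
  have hx1 := hex.tsum_eq_traceNorm hρ.1
  have hy1 := hfy.tsum_eq_traceNorm hσ.1
  rw [(isState_iff.1 hρ).2] at hx1
  rw [(isState_iff.1 hσ).2] at hy1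
  rw [relEntropy_eq hex hfy, relEntropy_eq hex hfy']
  have hlog : 0 ≤ -Real.log c := neg_nonneg.2 (Real.log_nonpos hc.le hc1)
  have key : entropySeries e f x (fun j => c * y j) + ENNReal.ofReal (1 - c) =
      entropySeries e f x y + ENNReal.ofReal (-Real.log c) := by
    have h1 : ENNReal.ofReal (1 - c) = ∑' (i) (j),
        ENNReal.ofReal (‖⟪e i, f j⟫_ℂ‖ ^ 2) * ENNReal.ofReal ((1 - c) * y j) := by
      rw [tsum_overlap_mul_right e f fun j => ENNReal.ofReal ((1 - c) * y j)]
      simp_rw [ENNReal.ofReal_mul (sub_nonneg.2 hc1)]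
      rw [ENNReal.tsum_mul_left, hy1, mul_one]
    have h2 : ENNReal.ofReal (-Real.log c) = ∑' (i) (j),
        ENNReal.ofReal (‖⟪e i, f j⟫_ℂ‖ ^ 2) * ENNReal.ofReal (-Real.log c * x i) := by
      rw [tsum_overlap_mul_left e f fun i => ENNReal.ofReal (-Real.log c * x i)]
      simp_rw [ENNReal.ofReal_mul hlog]
      rw [ENNReal.tsum_mul_left, hx1, mul_one]
    rw [h1, h2]
    unfold entropySeries
    simp_rw [← ENNReal.tsum_add, ← mul_add]
    refine tsum_congr fun i => tsum_congr fun j => ?_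
    rw [entropyTerm_mul (hx i) (hy j) hc hc1]
  refine ENNReal.le_of_add_le_add_right (a := ENNReal.ofReal (-Real.log c)) ENNReal.ofReal_ne_top ?_
  rw [← key]
  gcongr
  have := Real.log_le_sub_one_of_pos hc
  linarith

theorem relEntropy_zero_right {ρ : H →L[ℂ] H} (hρ : IsState ρ) : relEntropy ρ 0 = ∞ := by
  obtain ⟨S, e, x, hex⟩ := exists_spectralDecomposition hρ.1 hρ.2.1
  have h0 : IsSpectralDecomposition (0 : H →L[ℂ] H) (someBasis H) fun _ => 0 := fun j => by simp
  have hx1 := hex.tsum_eq_traceNorm hρ.1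
  rw [(isState_iff.1 hρ).2] at hx1
  obtain ⟨i, hi⟩ : ∃ i, x i ≠ 0 := by
    by_contra! hcon
    simp [hcon] at hx1
  rw [relEntropy_eq hex h0, eq_top_iff]
  unfold entropySeries
  refine le_trans ?_ (ENNReal.le_tsum i)
  simp_rw [entropyTerm, if_neg hi, if_true, norm_inner_symm (𝕜 := ℂ) (e i)]
  rw [ENNReal.tsum_mul_right, tsum_sq_norm_inner, e.orthonormal.1 i]
  simp

end States

/-! ### Attainment and lower semi-continuity of the infimum. -/

section Attainability

open Filter

variable {m : ℕ} {H : Fin m → Type*} [∀ i, NormedAddCommGroup (H i)]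
  [∀ i, InnerProductSpace ℂ (H i)] [∀ i, CompleteSpace (H i)] {P : Set (Partition m)}

/-- If one factor were zero, so would be the tensor product, which then carries no state; hence unit
vectors exist in every factor. -/
theorem pureProductStates_nonempty (hP : P.Nonempty) {ρ : HTensor H →L[ℂ] HTensor H}
    (hρ : IsState ρ) : (pureProductStates H P).Nonempty := by
  have hnt : ∀ i, Nontrivial (H i) := by
    intro i
    by_contra hi
    rw [not_nontrivial_iff_subsingleton] at hi
    have h0 : ∀ u : HTensor H, u = 0 := fun u => ext_inner_tmul fun x => by
      have hx : tmul x = 0 := by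
        rw [← norm_eq_zero, norm_tmul]
        exact Finset.prod_eq_zero (Finset.mem_univ i) (by rw [Subsingleton.elim (x i) 0, norm_zero])
      rw [hx, inner_zero_left, inner_zero_left]
    have hρ0 : ρ = 0 := ContinuousLinearMap.ext fun u => h0 _
    have := (isState_iff.1 hρ).2
    rw [hρ0, traceNorm_zero] at this
    exact zero_ne_one this
  obtain ⟨p, hp⟩ := hP
  choose x hx using fun i => exists_norm_eq (E := H i) zero_le_one
  refine ⟨_, p, hp, _, tmul x, fun B => ?_, isBlockProduct_tmul p x, rfl⟩
  rw [norm_tmul]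
  exact Finset.prod_eq_one fun i _ => hx i

variable [∀ i, TopologicalSpace.SeparableSpace (H i)]

/-- Common core of both claims: constant `ρ'` with a minimising sequence gives attainment, varying
`ρ'` gives semi-continuity. -/
theorem exists_relEntropy_le (hP : P.Nonempty) {ρ : HTensor H →L[ℂ] HTensor H}
    {ρ' σ' : ℕ → HTensor H →L[ℂ] HTensor H} (hρ : IsState ρ) (hρ' : ∀ n, IsState (ρ' n))
    (hσ' : ∀ n, σ' n ∈ separableStates H P)
    (hlim : ∀ u v, Tendsto (fun n => ⟪u, ρ' n v⟫_ℂ) atTop (𝓝 ⟪u, ρ v⟫_ℂ))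
    {b : ℕ → ℝ≥0∞} {L : ℝ≥0∞} (hb : ∀ n, relEntropy (ρ' n) (σ' n) ≤ b n)
    (hbL : Tendsto b atTop (𝓝 L)) : ∃ σ ∈ separableStates H P, relEntropy ρ σ ≤ L := by
  have hstate : ∀ n, IsState (σ' n) := fun n => isState_of_mem_separableStates (hσ' n)
  have htn : ∀ n, traceNorm (σ' n) ≤ 1 := fun n => (isState_iff.1 (hstate n)).2.le
  obtain ⟨φ, hφ, T, hT⟩ := exists_subseq_tendsto_inner fun n =>
    norm_le_one_of_traceNorm_le_one (htn n)
  have hTp : T.IsPositive := isPositive_of_tendsto_inner (fun n => (hstate (φ n)).1) hT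
  have hTn : traceNorm T ≤ 1 :=
    traceNorm_le_of_tendsto_inner (fun n => (hstate (φ n)).1) (fun n => htn _) hT
  have hTt : IsTraceClass T := hTn.trans_lt ENNReal.one_lt_top
  have hcone : T ∈ cone (separableStates H P) := by
    refine mem_cone_of_approx (pureProductStates_nonempty hP hρ) hTp hTt fun A ε hε => ?_
    have hev : ∀ᶠ n in atTop, ∀ x ∈ A, ∀ y ∈ A, ‖⟪x, (T - σ' (φ n)) y⟫_ℂ‖ < ε := by
      rw [eventually_all_finset]
      intro x _
      rw [eventually_all_finset]
      intro y _
      filter_upwards [Metric.tendsto_nhds.1 (hT x y) ε hε] with n hn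
      rwa [dist_comm, dist_eq_norm, ← inner_sub_right, ← sub_apply] at hn
    obtain ⟨n, hn⟩ := hev.exists
    exact ⟨σ' (φ n), ⟨1, zero_le_one, σ' (φ n), hσ' _, (one_smul _ _).symm⟩, hn⟩
  have hle : relEntropy ρ T ≤ L := by
    refine (relEntropy_le_liminf hρ.1 hTp hρ.2.1 hTt (fun n => (hρ' (φ n)).1)
      (fun n => (hstate (φ n)).1) (fun n => (hρ' (φ n)).2.1) (fun n => (hstate (φ n)).2.1)
      (fun u v => (hlim u v).comp hφ.tendsto_atTop) hT).trans ?_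
    rw [← (hbL.comp hφ.tendsto_atTop).liminf_eq]
    exact liminf_le_liminf (Eventually.of_forall fun n => hb _)
  obtain ⟨c, hc, σ, hσ, rfl⟩ := hcone
  refine ⟨σ, hσ, ?_⟩
  have hσs := isState_of_mem_separableStates hσ
  -- For `c = 0` all trace has escaped, which forces `L = ∞` and makes any `σ` suitable. Otherwise
  -- `c ≤ 1` is the trace bound on the limit.
  rcases hc.eq_or_lt with rfl | hc0
  · rw [zero_smul, relEntropy_zero_right hρ, top_le_iff] at hle
    rw [hle]
    exact le_top
  · refine (relEntropy_le_relEntropy_smul hρ hσs hc0 ?_).trans hle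
    rwa [traceNorm_real_smul hc, (isState_iff.1 hσs).2, mul_one, ENNReal.ofReal_le_one] at hTn

theorem exists_relEntropyOfEntanglement_eq (hP : P.Nonempty) {ρ : HTensor H →L[ℂ] HTensor H}
    (hρ : IsState ρ) :
    ∃ σ ∈ separableStates H P, relEntropyOfEntanglement H P ρ = relEntropy ρ σ := by
  set L := relEntropyOfEntanglement H P ρ with hL
  have hex : ∀ n : ℕ, ∃ σ ∈ separableStates H P, relEntropy ρ σ ≤ L + ((n : ℝ≥0∞) + 1)⁻¹ := by
    intro n
    -- For `L = ∞` there is no strict inequality `L < L + 1/(n+1)` to exploit, but any pure product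
    -- state will do.
    rcases eq_or_ne L ∞ with htop | htop
    · obtain ⟨X, hX⟩ := pureProductStates_nonempty hP hρ
      refine ⟨X, ⟨?_, fun ε hε => ⟨X, subset_convexHull ℝ _ hX, by simpa using hε⟩⟩, ?_⟩
      · rw [IsTraceClass, (isPositive_traceNorm_of_mem_convexHull (subset_convexHull ℝ _ hX)).2]
        exact ENNReal.one_lt_top
      · rw [htop, top_add]
        exact le_top
    · have hlt : L < L + ((n : ℝ≥0∞) + 1)⁻¹ := ENNReal.lt_add_right htop
        (ENNReal.inv_ne_zero.2
          (ENNReal.add_ne_top.2 ⟨ENNReal.natCast_ne_top n, ENNReal.one_ne_top⟩))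
      rw [hL, relEntropyOfEntanglement, relEntropyOfResource] at hlt
      simp_rw [iInf_lt_iff] at hlt
      obtain ⟨σ, hσ, h⟩ := hlt
      exact ⟨σ, hσ, h.le⟩
  choose σ' hσ' hle using hex
  have hbL : Tendsto (fun n : ℕ => L + ((n : ℝ≥0∞) + 1)⁻¹) atTop (𝓝 L) := by
    have h1 : Tendsto (fun n : ℕ => ((n : ℝ≥0∞) + 1)⁻¹) atTop (𝓝 0) := by
      have := ENNReal.tendsto_inv_nat_nhds_zero.comp (tendsto_add_atTop_nat 1)
      refine this.congr fun n => ?_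
      simp
    simpa using h1.const_add L
  obtain ⟨σ, hσ, h⟩ := exists_relEntropy_le hP hρ (fun _ => hρ) hσ'
    (fun u v => tendsto_const_nhds) hle hbL
  exact ⟨σ, hσ, le_antisymm (iInf₂_le σ hσ) h⟩

theorem relEntropyOfEntanglement_le_liminf (hP : P.Nonempty) {ρ : HTensor H →L[ℂ] HTensor H}
    {ρ' : ℕ → HTensor H →L[ℂ] HTensor H} (hρ : IsState ρ) (hρ' : ∀ n, IsState (ρ' n))
    (hlim : Tendsto (fun n => traceNorm (ρ' n - ρ)) atTop (𝓝 0)) :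
    relEntropyOfEntanglement H P ρ ≤
      liminf (fun n => relEntropyOfEntanglement H P (ρ' n)) atTop := by
  by_contra! hlt
  -- A level strictly between the liminf and the value at `ρ` is undercut along a subsequence by
  -- separable states; their limit undercuts it at `ρ`.
  obtain ⟨c, hc1, hc2⟩ := exists_between hlt
  obtain ⟨φ, hφ, hφc⟩ := extraction_of_frequently_atTop
    (frequently_lt_of_liminf_lt (by isBoundedDefault) hc1)
  have hex : ∀ n, ∃ σ ∈ separableStates H P, relEntropy (ρ' (φ n)) σ ≤ c := fun n => by
    have h := hφc n
    rw [relEntropyOfEntanglement, relEntropyOfResource] at h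
    simp_rw [iInf_lt_iff] at h
    obtain ⟨σ, hσ, h⟩ := h
    exact ⟨σ, hσ, h.le⟩
  choose σ' hσ' hle using hex
  obtain ⟨σ, hσ, h⟩ := exists_relEntropy_le hP hρ (fun n => hρ' (φ n)) hσ'
    (fun u v => (tendsto_inner_of_tendsto_traceNorm hlim u v).comp hφ.tendsto_atTop) hle
    tendsto_const_nhds
  exact absurd ((iInf₂_le σ hσ).trans h) (not_le.2 hc2)

end Attainability

end PiEntanglement

end

open PiEntanglement Filter in
theorem mainTheorem5 {m : ℕ} (hm : 0 < m) (H : Fin m → Type*)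
    [∀ i, NormedAddCommGroup (H i)] [∀ i, InnerProductSpace ℂ (H i)]
    [∀ i, CompleteSpace (H i)] [∀ i, TopologicalSpace.SeparableSpace (H i)] :
    (∀ P : Set (Partition m), P.Nonempty →
      IsWeakStarClosed (cone (separableStates H P)) ∧
      (∀ ρ : HTensor H →L[ℂ] HTensor H, IsState ρ →
        ∃ σ ∈ separableStates H P, IsState σ ∧
          relEntropyOfEntanglement H P ρ = relEntropy ρ σ) ∧
      (∀ (ρ : HTensor H →L[ℂ] HTensor H) (ρ' : ℕ → HTensor H →L[ℂ] HTensor H),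
        IsState ρ → (∀ n, IsState (ρ' n)) →
        Tendsto (fun n => traceNorm (ρ' n - ρ)) atTop (𝓝 0) →
        relEntropyOfEntanglement H P ρ ≤
          liminf (fun n => relEntropyOfEntanglement H P (ρ' n)) atTop)) ∧
    (∀ k : ℕ, 1 ≤ k → k ≤ m →
      IsWeakStarClosed (cone (separableStates H (kSeparable m k))) ∧
      IsWeakStarClosed (cone (separableStates H (kProducible m k)))) := by
  refine ⟨fun P hP => ⟨isWeakStarClosed_cone, fun ρ hρ => ?_, fun ρ ρ' hρ hρ' hlim =>
    relEntropyOfEntanglement_le_liminf hP hρ hρ' hlim⟩,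
    fun k _ _ => ⟨isWeakStarClosed_cone, isWeakStarClosed_cone⟩⟩
  obtain ⟨σ, hσ, h⟩ := exists_relEntropyOfEntanglement_eq hP hρ
  exact ⟨σ, hσ, isState_of_mem_separableStates hσ, h⟩
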